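/- Let $p$ be an odd prime and $\mathbb F_p=\mathbb Z/p$, $\xi=e^{2\pi i/p}$. **Relations.** A *type* is a formal sum $X=Q(V,\omega)\oplus W$ of a finite-dimensional symplectic $\mathbb F_p$-vector space $(V,\omega)$ (the quantum part) and a finite-dimensional $\mathbb F_p$-vector space $W$ (the classical part); its set of points is $V\oplus W$. An affine coisotropic relation from $(V,\omega)$ to $(V',\omega')$ is a subset of $V\oplus V'$ that is empty or an affine subspace whose direction $D$ contains its complement $D^{\perp}$ with respect to $-\omega\oplus\omega'$; an affine relation from $W$ to $W'$ is a possibly empty affine subspace of $W\oplus W'$. The category $\mathsf{AR}^Q$ has the types as objects; its morphisms $X\to Y$ are the relations between the sets of points that are generated, under relational composition and direct sum, by the direct sums of an affine coisotropic relation between quantum parts and an affine relation between classical parts, the $Z$-measurement $\mu_Z=\{((x,z),x)\}:Q(\mathbb F_p^2,\omega_1)\to\mathbb F_p$ with $\omega_1((x,z),(x',z'))=xz'-zx'$, and its converse $\mu_Z^\dagger$. The category $\mathsf{NL}^Q$ has the same objects; its morphisms are generated, under composition, direct sum and converse, by those of $\mathsf{AR}^Q$ and the multiplication relation $\{((a,b),ab)\}:\mathbb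 F_p^2\to\mathbb F_p$. For $\mathsf C=\mathsf{AR}^Q,\mathsf{NL}^Q$ let $\operatorname{Total}(\mathsf C)$ be the subcategory with all objects and with those morphisms $R:X\to Y$ for which every point of $X$ is related to at least one point of $Y$. There is an inclusion functor $J:\operatorname{Total}(\mathsf{AR}^Q)\to\operatorname{Total}(\mathsf{NL}^Q)$, the identity on objects and on relations. **Stabiliser channels.** On $n$ qupits, with Hilbert space $\mathbb C[\mathbb F_p^n]$, the Pauli operators are $|j\rangle\mapsto\xi^{a+z\cdot j}|j+x\rangle$ with $a\in\mathbb F_p$, $x,z\in\mathbb F_p^n$. A stabiliser group is an Abelian group of Pauli operators that contains no $\xi^a 1$ with $a\neq0$ and is maximal among such groups; a stabiliser state is a unit vector fixed by a stabiliser group; a Clifford operator is a unitary that conjugates Pauli operators to Pauli operators. $\mathsf{Stab}_p$ consists of the linear maps generated by stabiliser states, Clifford operators and the scalars $p^{\pm1/2}$ under composition, tensor product and adjoint, and $\operatorname{CPM}(\mathsf{Stab}_p)$ of the superoperators $\rho\mapsto f(\rho\otimes 1)f^\dagger$ with $f$ in $\mathsf{Stab}_p$. The category $\mathsf{StabChan}_p=\operatorname{Caus}(\operatorname{Split}^\dagger(\operatorname{CPM}(\mathsf{Stab}_p)))$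 has as objects the nonzero superoperators $e$ in $\operatorname{CPM}(\mathsf{Stab}_p)$ with $e\circ e=e$ that are self-adjoint for the Hilbert–Schmidt inner product; a morphism $e\to e'$ is a superoperator $\Phi$ in $\operatorname{CPM}(\mathsf{Stab}_p)$ with $e'\circ\Phi\circ e=\Phi$ and $\operatorname{tr}\Phi(\rho)=\operatorname{tr}e(\rho)$ for all $\rho$; the identity of $e$ is $e$. **The equivalence.** Let $E:\operatorname{Total}(\mathsf{AR}^Q)\xrightarrow{\ \simeq\ }\mathsf{StabChan}_p$ be the following functor. After a choice of Darboux coordinates of $V$ and linear coordinates of $W$, identify $X=Q(V,\omega)\oplus W$ with $Q(\mathbb F_p^{2n},\omega_n)\oplus\mathbb F_p^m$. For a point $(x,z,w)$ of $X$ put $A_{(x,z,w)}=A_{x,z}\otimes|w\rangle\langle w|$ on $n+m$ qupits, where $A_{x,z}$ is the phase-point operator $|j\rangle\mapsto\xi^{2z\cdot(x-j)}|2x-j\rangle$. Then $E(X)$ is the channel on $n+m$ qupits that decoheres the last $m$ qupits in the computational basis, and for a total relation $R:X\to Y$ of $\mathsf{AR}^Q$ $$E(R)(\rho)=\sum_{a\in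 X}\frac{\operatorname{tr}(A_a\rho)}{p^{n}}\cdot\frac1{|\{b:(a,b)\in R\}|}\sum_{b:(a,b)\in R}A_b .$$ **Proposition.** There is no functor $F:\operatorname{Total}(\mathsf{NL}^Q)\to\mathsf{StabChan}_p$ that extends $E$ along the inclusion, that is, no functor $F$ for which $F\circ J$ is naturally isomorphic to $E$; in particular there is none with $F\circ J=E$. -/

import Mathlib

open CategoryTheory

/-- A finite-dimensional vector space over the field with `p` elements. -/
structure VecSpace (p : ℕ) [Fact p.Prime] where
  carrier : Type
  [addCommGroup : AddCommGroup carrier]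
  [module : Module (ZMod p) carrier]
  [finite : Module.Finite (ZMod p) carrier]

attribute [instance] VecSpace.addCommGroup VecSpace.module VecSpace.finite

/-- A finite-dimensional symplectic vector space over the field with `p` elements. -/
structure SympSpace (p : ℕ) [Fact p.Prime] where
  carrier : Type
  [addCommGroup : AddCommGroup carrier]
  [module : Module (ZMod p) carrier]
  [finite : Module.Finite (ZMod p) carrier]
  form : LinearMap.BilinForm (ZMod p) carrier
  alt : form.IsAlt
  nondegenerate : form.Nondegenerate

attribute [instance] SympSpace.addCommGroup SympSpace.module SympSpace.finite

/-- The symplectic form on `F_p^{2n}`: `ω((x, z), (x', z')) = x ⬝ z' - z ⬝ x'`. -/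
def stdForm (p : ℕ) (ι : Type) [Fintype ι] :
    LinearMap.BilinForm (ZMod p) ((ι → ZMod p) × (ι → ZMod p)) :=
  LinearMap.mk₂ (ZMod p) (fun v w => v.1 ⬝ᵥ w.2 - v.2 ⬝ᵥ w.1)
    (by intro a b c; simp [add_dotProduct]; ring)
    (by intro r a b; simp [mul_sub])
    (by intro a b c; simp [dotProduct_add]; ring)
    (by intro r a b; simp [mul_sub])

theorem stdForm_apply (p : ℕ) (ι : Type) [Fintype ι] (v w : (ι → ZMod p) × (ι → ZMod p)) :
    stdForm p ι v w = v.1 ⬝ᵥ w.2 - v.2 ⬝ᵥ w.1 := rfl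

theorem stdForm_isAlt (p : ℕ) (ι : Type) [Fintype ι] : (stdForm p ι).IsAlt := by
  intro v
  rw [stdForm_apply, dotProduct_comm]; ring

theorem nondegenerate_of_isAlt {p : ℕ} [Fact p.Prime] {V : Type} [AddCommGroup V]
    [Module (ZMod p) V] {B : LinearMap.BilinForm (ZMod p) V} (hB : B.IsAlt)
    (h : ∀ v, (∀ w, B v w = 0) → v = 0) : B.Nondegenerate :=
  ⟨h, fun v hv => h v fun w => hB.isRefl _ _ (hv w)⟩

theorem stdForm_nondegenerate (p : ℕ) [Fact p.Prime] (ι : Type) [Fintype ι] [DecidableEq ι] :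
    (stdForm p ι).Nondegenerate := by
  refine nondegenerate_of_isAlt (stdForm_isAlt p ι) fun v hv => ?_
  refine Prod.ext ?_ ?_
  · ext i
    simpa [stdForm_apply] using hv (0, Pi.single i 1)
  · ext i
    simpa [stdForm_apply] using hv (Pi.single i 1, 0)

namespace SympSpace

variable {p : ℕ} [Fact p.Prime]

/-- The standard symplectic space `F_p^{2n}`. -/
abbrev std (p : ℕ) [Fact p.Prime] (n : ℕ) : SympSpace p where
  carrier := (Fin n → ZMod p) × (Fin n → ZMod p)
  form := stdForm p (Fin n)
  alt := stdForm_isAlt p (Fin n)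
  nondegenerate := stdForm_nondegenerate p (Fin n)

/-- The dual `(V, -ω)`. -/
abbrev dual (V : SympSpace p) : SympSpace p where
  carrier := V.carrier
  form := -V.form
  alt := fun v => by simp [V.alt v]
  nondegenerate := nondegenerate_of_isAlt (fun v => by simp [V.alt v]) fun v hv =>
    V.nondegenerate.1 v fun w => by simpa using hv w

/-- The form `ω_V ⊕ ω_W` on `V ⊕ W`. -/
def sumForm (V W : SympSpace p) : LinearMap.BilinForm (ZMod p) (V.carrier × W.carrier) :=
  V.form.compl₁₂ (LinearMap.fst _ _ _) (LinearMap.fst _ _ _) +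
    W.form.compl₁₂ (LinearMap.snd _ _ _) (LinearMap.snd _ _ _)

theorem sumForm_apply (V W : SympSpace p) (a b : V.carrier × W.carrier) :
    sumForm V W a b = V.form a.1 b.1 + W.form a.2 b.2 := rfl

/-- The direct sum of symplectic spaces. -/
abbrev sum (V W : SympSpace p) : SympSpace p where
  carrier := V.carrier × W.carrier
  form := sumForm V W
  alt := fun v => by simp [sumForm_apply, V.alt v.1, W.alt v.2]
  nondegenerate := nondegenerate_of_isAlt
    (fun v => by simp [sumForm_apply, V.alt v.1, W.alt v.2]) fun v hv => by
      refine Prod.ext (V.nondegenerate.1 _ fun w => ?_) (W.nondegenerate.1 _ fun w => ?_)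
      · simpa [sumForm_apply] using hv (w, 0)
      · simpa [sumForm_apply] using hv (0, w)

/-- A linear subspace is coisotropic when it contains its symplectic complement. -/
def IsCoisotropic (V : SympSpace p) (S : Submodule (ZMod p) V.carrier) : Prop :=
  V.form.orthogonal S ≤ S

/-- Affine coisotropic subspaces; by convention the empty set is one of them. -/
def IsAffineCoisotropic (V : SympSpace p) (C : Set V.carrier) : Prop :=
  C = ∅ ∨ ∃ A : AffineSubspace (ZMod p) V.carrier, (A : Set V.carrier) = C ∧
    V.IsCoisotropic A.direction

end SympSpace

/-- The coordinate space `F_p^n`. -/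
abbrev VecSpace.std (p : ℕ) [Fact p.Prime] (n : ℕ) : VecSpace p where
  carrier := Fin n → ZMod p

/-- The direct sum of vector spaces. -/
abbrev VecSpace.sum {p : ℕ} [Fact p.Prime] (V W : VecSpace p) : VecSpace p where
  carrier := V.carrier × W.carrier

/-- (Possibly empty) affine subspaces of an `F_p`-vector space. -/
def IsAffineSet (p : ℕ) [Fact p.Prime] {V : Type} [AddCommGroup V] [Module (ZMod p) V]
    (C : Set V) : Prop :=
  ∃ A : AffineSubspace (ZMod p) V, (A : Set V) = C

/-! ### Relations -/

/-- Relational composition: first `R`, then `S`. -/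
def relComp {A B C : Type} (R : Set (A × B)) (S : Set (B × C)) : Set (A × C) :=
  {z | ∃ b, (z.1, b) ∈ R ∧ (b, z.2) ∈ S}

/-- The diagonal relation. -/
def relId (A : Type) : Set (A × A) := {z | z.1 = z.2}

/-- The converse relation. -/
def relConverse {A B : Type} (R : Set (A × B)) : Set (B × A) := {z | (z.2, z.1) ∈ R}

/-- The parallel composite of two relations. -/
def relSum {A B C D : Type} (R : Set (A × B)) (S : Set (C × D)) : Set ((A × C) × (B × D)) :=
  {z | (z.1.1, z.2.1) ∈ R ∧ (z.1.2, z.2.2) ∈ S}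

/-- Total relations: every point of the source is related to some point of the target. -/
def relTotal {A B : Type} (R : Set (A × B)) : Prop := ∀ a, ∃ b, (a, b) ∈ R

/-- Mixed quantum-classical types `Q(V, ω) ⊕ W`, with `(V, ω)` a symplectic vector space and `W` a
vector space. -/
structure QCSpace (p : ℕ) [Fact p.Prime] where
  quantum : SympSpace p
  classical : VecSpace p

namespace QCSpace

variable {p : ℕ} [Fact p.Prime]

/-- The underlying vector space of `Q(V, ω) ⊕ W`. -/
abbrev Pt (X : QCSpace p) : Type := X.quantum.carrier × X.classical.carrier

/-- The purely quantum type `Q(V, ω)`. -/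
abbrev ofQuantum (V : SympSpace p) : QCSpace p := ⟨V, VecSpace.std p 0⟩

/-- The purely classical type `W`. -/
abbrev ofClassical (W : VecSpace p) : QCSpace p := ⟨SympSpace.std p 0, W⟩

/-- The direct sum of types. -/
abbrev sum (X Y : QCSpace p) : QCSpace p := ⟨X.quantum.sum Y.quantum, X.classical.sum Y.classical⟩

/-- The parallel composite of relations between types. -/
def sumRel {X Y X' Y' : QCSpace p} (R : Set (X.Pt × Y.Pt)) (S : Set (X'.Pt × Y'.Pt)) :
    Set ((X.sum X').Pt × (Y.sum Y').Pt) :=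
  {z | ((z.1.1.1, z.1.2.1), (z.2.1.1, z.2.2.1)) ∈ R ∧
    ((z.1.1.2, z.1.2.2), (z.2.1.2, z.2.2.2)) ∈ S}

/-- The `Z`-measurement relation `{((x, z), x)} : Q(F_p^2, ω_1) → F_p`. -/
def measZ (p : ℕ) [Fact p.Prime] :
    Set ((ofQuantum (SympSpace.std p 1)).Pt × (ofClassical (VecSpace.std p 1)).Pt) :=
  {r | r.2.2 = r.1.1.1}

/-- The multiplication relation `{((a, b), a b)} : F_p^2 → F_p`. -/
def mulRel (p : ℕ) [Fact p.Prime] :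
    Set ((ofClassical (VecSpace.std p 2)).Pt × (ofClassical (VecSpace.std p 1)).Pt) :=
  {r | ∃ a b : ZMod p, r.1.2 = ![a, b] ∧ r.2.2 = ![a * b]}

end QCSpace

/-- The morphisms of `AR^Q`: the relations generated by affine coisotropic relations between the
quantum parts, affine relations between the classical parts, the `Z`-measurement and the `Z`-state
preparation, under composition and direct sum. -/
inductive ARQRel (p : ℕ) [Fact p.Prime] : ∀ X Y : QCSpace p, Set (X.Pt × Y.Pt) → Prop
  | glue (X Y : QCSpace p) (R : Set (X.quantum.carrier × Y.quantum.carrier))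
      (S : Set (X.classical.carrier × Y.classical.carrier))
      (hR : (X.quantum.dual.sum Y.quantum).IsAffineCoisotropic R) (hS : IsAffineSet p S) :
      ARQRel p X Y (relSum R S)
  | meas : ARQRel p _ _ (QCSpace.measZ p)
  | prep : ARQRel p _ _ (relConverse (QCSpace.measZ p))
  | comp (X Y Z : QCSpace p) (R : Set (X.Pt × Y.Pt)) (S : Set (Y.Pt × Z.Pt)) :
      ARQRel p X Y R → ARQRel p Y Z S → ARQRel p X Z (relComp R S)
  | sum (X Y X' Y' : QCSpace p) (R : Set (X.Pt × Y.Pt)) (S : Set (X'.Pt × Y'.Pt)) :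
      ARQRel p X Y R → ARQRel p X' Y' S → ARQRel p (X.sum X') (Y.sum Y') (QCSpace.sumRel R S)

/-- The morphisms of `NL^Q`: the relations generated by those of `AR^Q` and the multiplication
relation, under composition, direct sum and converse. -/
inductive NLQRel (p : ℕ) [Fact p.Prime] : ∀ X Y : QCSpace p, Set (X.Pt × Y.Pt) → Prop
  | ofARQ (X Y : QCSpace p) (R : Set (X.Pt × Y.Pt)) : ARQRel p X Y R → NLQRel p X Y R
  | mul : NLQRel p _ _ (QCSpace.mulRel p)
  | comp (X Y Z : QCSpace p) (R : Set (X.Pt × Y.Pt)) (S : Set (Y.Pt × Z.Pt)) :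
      NLQRel p X Y R → NLQRel p Y Z S → NLQRel p X Z (relComp R S)
  | sum (X Y X' Y' : QCSpace p) (R : Set (X.Pt × Y.Pt)) (S : Set (X'.Pt × Y'.Pt)) :
      NLQRel p X Y R → NLQRel p X' Y' S → NLQRel p (X.sum X') (Y.sum Y') (QCSpace.sumRel R S)
  | dagger (X Y : QCSpace p) (R : Set (X.Pt × Y.Pt)) : NLQRel p X Y R → NLQRel p Y X (relConverse R)

theorem relId_coisotropic {p : ℕ} [Fact p.Prime] (V : SympSpace p) :
    (V.dual.sum V).IsAffineCoisotropic (relId V.carrier) := by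
  refine Or.inr ⟨(LinearMap.eqLocus (LinearMap.fst (ZMod p) V.carrier V.carrier)
    (LinearMap.snd (ZMod p) V.carrier V.carrier)).toAffineSubspace, rfl, ?_⟩
  intro d hd
  rw [Submodule.toAffineSubspace_direction] at hd ⊢
  have h : ∀ w, V.form w (d.2 - d.1) = 0 := fun w => by
    have : -V.form w d.1 + V.form w d.2 = 0 := hd (w, w) rfl
    rw [map_sub]; linear_combination this
  have := V.nondegenerate.2 _ h
  exact (sub_eq_zero.1 this).symm

theorem ARQRel.id {p : ℕ} [Fact p.Prime] (X : QCSpace p) : ARQRel p X X (relId X.Pt) := by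
  have h := ARQRel.glue X X _ _ (relId_coisotropic X.quantum)
    ⟨(LinearMap.eqLocus (LinearMap.fst (ZMod p) X.classical.carrier X.classical.carrier)
      (LinearMap.snd (ZMod p) X.classical.carrier X.classical.carrier)).toAffineSubspace, rfl⟩
  convert h using 1
  ext z
  exact Prod.ext_iff

theorem relComp_id {A B : Type} (R : Set (A × B)) : relComp R (relId B) = R := by
  ext ⟨a, b⟩; simp [relComp, relId]

theorem id_relComp {A B : Type} (R : Set (A × B)) : relComp (relId A) R = R := by
  ext ⟨a, b⟩; simp [relComp, relId]

theorem relComp_assoc {A B C D : Type} (R : Set (A × B)) (S : Set (B × C)) (T : Set (C × D)) :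
    relComp (relComp R S) T = relComp R (relComp S T) := by
  ext ⟨a, d⟩
  simp only [relComp, Set.mem_ofPred_eq]
  tauto

theorem relTotal_comp {A B C : Type} {R : Set (A × B)} {S : Set (B × C)} (hR : relTotal R)
    (hS : relTotal S) : relTotal (relComp R S) := fun a =>
  let ⟨b, hb⟩ := hR a
  let ⟨c, hc⟩ := hS b
  ⟨c, b, hb, hc⟩

theorem relTotal_id (A : Type) : relTotal (relId A) := fun a => ⟨a, rfl⟩

/-- The objects of `Total(AR^Q)`. -/
structure TotalARQ (p : ℕ) [Fact p.Prime] where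
  space : QCSpace p

/-- The objects of `Total(NL^Q)`. -/
structure TotalNLQ (p : ℕ) [Fact p.Prime] where
  space : QCSpace p

/-- The morphisms of `Total(AR^Q)`: the total relations among the morphisms of `AR^Q`. -/
@[ext] structure TotalARQ.Hom {p : ℕ} [Fact p.Prime] (X Y : TotalARQ p) where
  rel : Set (X.space.Pt × Y.space.Pt)
  isARQ : ARQRel p X.space Y.space rel
  total : relTotal rel

/-- The morphisms of `Total(NL^Q)`: the total relations among the morphisms of `NL^Q`. -/
@[ext] structure TotalNLQ.Hom {p : ℕ} [Fact p.Prime] (X Y : TotalNLQ p) where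
  rel : Set (X.space.Pt × Y.space.Pt)
  isNLQ : NLQRel p X.space Y.space rel
  total : relTotal rel

instance (p : ℕ) [Fact p.Prime] : Category (TotalARQ p) where
  Hom := TotalARQ.Hom
  id _ := ⟨relId _, ARQRel.id _, relTotal_id _⟩
  comp f g := ⟨relComp f.rel g.rel, .comp _ _ _ _ _ f.isARQ g.isARQ, relTotal_comp f.total g.total⟩
  id_comp _ := TotalARQ.Hom.ext (id_relComp _)
  comp_id _ := TotalARQ.Hom.ext (relComp_id _)
  assoc _ _ _ := TotalARQ.Hom.ext (relComp_assoc _ _ _)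

instance (p : ℕ) [Fact p.Prime] : Category (TotalNLQ p) where
  Hom := TotalNLQ.Hom
  id _ := ⟨relId _, .ofARQ _ _ _ (ARQRel.id _), relTotal_id _⟩
  comp f g := ⟨relComp f.rel g.rel, .comp _ _ _ _ _ f.isNLQ g.isNLQ, relTotal_comp f.total g.total⟩
  id_comp _ := TotalNLQ.Hom.ext (id_relComp _)
  comp_id _ := TotalNLQ.Hom.ext (relComp_id _)
  assoc _ _ _ := TotalNLQ.Hom.ext (relComp_assoc _ _ _)

/-- The inclusion `Total(AR^Q) ↣ Total(NL^Q)`. -/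
def totalInclusion (p : ℕ) [Fact p.Prime] : TotalARQ p ⥤ TotalNLQ p where
  obj X := ⟨X.space⟩
  map f := ⟨f.rel, .ofARQ _ _ _ f.isARQ, f.total⟩
  map_id _ := rfl
  map_comp _ _ := rfl

/-- `C` is the coset of the linear subspace `S` through the point `a`. -/
def IsCoset {p : ℕ} {V : Type} [AddCommGroup V] [Module (ZMod p) V] (C : Set V) (a : V)
    (S : Submodule (ZMod p) V) : Prop :=
  ∀ x, x ∈ C ↔ x - a ∈ S

theorem IsCoset.of_affine {p : ℕ} [Fact p.Prime] {V : Type} [AddCommGroup V] [Module (ZMod p) V]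
    (A : AffineSubspace (ZMod p) V) {a : V} (ha : a ∈ A) : IsCoset (A : Set V) a A.direction :=
  fun x => (A.vsub_right_mem_direction_iff_mem ha x).symm

/-- The linear-algebraic content of the quantum-classical interface: the relation is empty, or a
coset of a linear subspace whose purely quantum part is coisotropic. -/
def QCSpace.Good {p : ℕ} [Fact p.Prime] (X Y : QCSpace p) (R : Set (X.Pt × Y.Pt)) : Prop :=
  R = ∅ ∨ ∃ (a : X.Pt × Y.Pt) (S : Submodule (ZMod p) (X.Pt × Y.Pt)), IsCoset R a S ∧
    ∀ (v : X.quantum.carrier) (v' : Y.quantum.carrier)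
      (α : Module.Dual (ZMod p) X.classical.carrier)
      (β : Module.Dual (ZMod p) Y.classical.carrier),
      (∀ d ∈ S, -X.quantum.form v d.1.1 + Y.quantum.form v' d.2.1 + α d.1.2 + β d.2.2 = 0) →
        ((v, 0), (v', 0)) ∈ S

theorem SympSpace.exists_form_eq {p : ℕ} [Fact p.Prime] (V : SympSpace p)
    (f : Module.Dual (ZMod p) V.carrier) : ∃ v, ∀ w, V.form v w = f w := by
  refine ⟨(LinearMap.BilinForm.toDual V.form V.nondegenerate).symm f, fun w => ?_⟩
  rw [← LinearMap.BilinForm.toDual_def (b := V.nondegenerate), LinearEquiv.apply_symm_apply]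

theorem QCSpace.good_glue {p : ℕ} [Fact p.Prime] (X Y : QCSpace p)
    (R : Set (X.quantum.carrier × Y.quantum.carrier))
    (S : Set (X.classical.carrier × Y.classical.carrier))
    (hR : (X.quantum.dual.sum Y.quantum).IsAffineCoisotropic R) (hS : IsAffineSet p S) :
    X.Good Y (relSum R S) := by
  obtain rfl | ⟨A, rfl, hA⟩ := hR
  · left; ext z; simp [relSum]
  obtain ⟨B, rfl⟩ := hS
  by_cases hne : (A : Set (X.quantum.carrier × Y.quantum.carrier)).Nonempty ∧
      (B : Set (X.classical.carrier × Y.classical.carrier)).Nonempty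
  · obtain ⟨⟨a, ha⟩, ⟨b, hb⟩⟩ := hne
    have hA' := IsCoset.of_affine A ha
    have hB' := IsCoset.of_affine B hb
    right
    refine ⟨((a.1, b.1), (a.2, b.2)),
      (A.direction.comap ((LinearMap.fst _ _ _).prodMap (LinearMap.fst _ _ _))) ⊓
      (B.direction.comap ((LinearMap.snd _ _ _).prodMap (LinearMap.snd _ _ _))), ?_, ?_⟩
    · intro z
      exact and_congr (hA' _) (hB' _)
    · intro v v' α β h
      refine ⟨hA fun d hd => ?_, ?_⟩
      · have := h ((d.1, 0), (d.2, 0)) ⟨hd, B.direction.zero_mem⟩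
        change -X.quantum.form d.1 v + Y.quantum.form d.2 v' = 0
        rw [← X.quantum.alt.neg_eq, ← Y.quantum.alt.neg_eq] 
        simp only [map_zero, add_zero] at this
        linear_combination -this
      · exact B.direction.zero_mem
  · left
    ext z
    simp only [relSum, Set.mem_ofPred_eq, Set.mem_empty_iff_false, iff_false]
    rintro ⟨h1, h2⟩
    exact hne ⟨⟨_, h1⟩, ⟨_, h2⟩⟩

theorem QCSpace.good_meas (p : ℕ) [Fact p.Prime] :
    QCSpace.Good (QCSpace.ofQuantum (SympSpace.std p 1)) (QCSpace.ofClassical (VecSpace.std p 1))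
      (QCSpace.measZ p) := by
  right
  refine ⟨0, LinearMap.eqLocus (LinearMap.snd _ _ _ ∘ₗ LinearMap.snd _ _ _)
    (LinearMap.fst _ _ _ ∘ₗ LinearMap.fst _ _ _ ∘ₗ LinearMap.fst _ _ _), ?_, ?_⟩
  · intro x
    rw [sub_zero]; rfl
  · intro v v' α β h
    have h1 := h (((0, Pi.single 0 1), 0), 0) rfl
    change 0 = v.1
    symm
    ext i
    fin_cases i
    have h2 : -(v.1 ⬝ᵥ Pi.single 0 1 - v.2 ⬝ᵥ 0) = 0 := by
      simpa [stdForm_apply] using h1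
    simpa using h2

theorem QCSpace.good_converse {p : ℕ} [Fact p.Prime] {X Y : QCSpace p} {R : Set (X.Pt × Y.Pt)}
    (h : X.Good Y R) : Y.Good X (relConverse R) := by
  obtain rfl | ⟨a, S, hS, h⟩ := h
  · left; rfl
  · right
    refine ⟨a.swap, S.comap (LinearEquiv.prodComm _ _ _).toLinearMap, fun x => hS (x.2, x.1), ?_⟩
    intro v v' α β h'
    have := h (-v') (-v) β α fun d hd => by
      have := h' d.swap hd
      simp only [Prod.fst_swap, Prod.snd_swap] at this
      simp only [map_neg, LinearMap.neg_apply, neg_neg]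
      linear_combination this
    have := S.neg_mem this
    simpa using this

theorem QCSpace.good_sum {p : ℕ} [Fact p.Prime] {X Y X' Y' : QCSpace p} {R : Set (X.Pt × Y.Pt)}
    {S : Set (X'.Pt × Y'.Pt)} (hR : X.Good Y R) (hS : X'.Good Y' S) :
    (X.sum X').Good (Y.sum Y') (QCSpace.sumRel R S) := by
  obtain rfl | ⟨a, K, hK, h⟩ := hR
  · left; ext z; simp [sumRel]
  obtain rfl | ⟨b, L, hL, h'⟩ := hS
  · left; ext z; simp [sumRel]
  right
  let f : (X.sum X').Pt × (Y.sum Y').Pt →ₗ[ZMod p] X.Pt × Y.Pt :=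
    ((LinearMap.fst _ _ _).prodMap (LinearMap.fst _ _ _)).prodMap
      ((LinearMap.fst _ _ _).prodMap (LinearMap.fst _ _ _))
  let g : (X.sum X').Pt × (Y.sum Y').Pt →ₗ[ZMod p] X'.Pt × Y'.Pt :=
    ((LinearMap.snd _ _ _).prodMap (LinearMap.snd _ _ _)).prodMap
      ((LinearMap.snd _ _ _).prodMap (LinearMap.snd _ _ _))
  refine ⟨(((a.1.1, b.1.1), (a.1.2, b.1.2)), ((a.2.1, b.2.1), (a.2.2, b.2.2))),
    K.comap f ⊓ L.comap g, fun x => and_congr (hK _) (hL _), ?_⟩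
  intro v v' α β hd
  refine ⟨h v.1 v'.1 (α ∘ₗ LinearMap.inl _ _ _) (β ∘ₗ LinearMap.inl _ _ _) fun d hd' => ?_,
    h' v.2 v'.2 (α ∘ₗ LinearMap.inr _ _ _) (β ∘ₗ LinearMap.inr _ _ _) fun d hd' => ?_⟩
  · have := hd (((d.1.1, 0), (d.1.2, 0)), ((d.2.1, 0), (d.2.2, 0))) ⟨hd', L.zero_mem⟩
    simpa [SympSpace.sumForm_apply] using this
  · have := hd (((0, d.1.1), (0, d.1.2)), ((0, d.2.1), (0, d.2.2))) ⟨K.zero_mem, hd'⟩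
    simpa [SympSpace.sumForm_apply] using this

theorem QCSpace.good_comp {p : ℕ} [Fact p.Prime] {X Y Z : QCSpace p} {R : Set (X.Pt × Y.Pt)}
    {S : Set (Y.Pt × Z.Pt)} (hR : X.Good Y R) (hS : Y.Good Z S) :
    X.Good Z (relComp R S) := by
  obtain rfl | ⟨a, K, hK, h⟩ := hR
  · left; ext z; simp [relComp]
  obtain rfl | ⟨b, L, hL, h'⟩ := hS
  · left; ext z; simp [relComp]
  by_cases hne : relComp R S = ∅
  · exact Or.inl hne
  right
  obtain ⟨⟨x, z⟩, y, hxy, hyz⟩ := Set.nonempty_iff_ne_empty.2 hne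
  have hK' : IsCoset R (x, y) K := fun w => by
    rw [hK]
    have h1 : (x, y) - a ∈ K := (hK _).1 hxy
    constructor
    · intro h2; have := K.sub_mem h2 h1; simpa using this
    · intro h2; have := K.add_mem h2 h1; simpa using this
  have hL' : IsCoset S (y, z) L := fun w => by
    rw [hL]
    have h1 : (y, z) - b ∈ L := (hL _).1 hyz
    constructor
    · intro h2; have := L.sub_mem h2 h1; simpa using this
    · intro h2; have := L.add_mem h2 h1; simpa using this
  let A : Submodule (ZMod p) (X.Pt × Y.Pt × Z.Pt) :=
    K.comap ((LinearMap.fst _ _ _).prod (LinearMap.fst _ _ _ ∘ₗ LinearMap.snd _ _ _))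
  let B : Submodule (ZMod p) (X.Pt × Y.Pt × Z.Pt) :=
    L.comap (LinearMap.snd _ _ _)
  refine ⟨(x, z), (A ⊓ B).map
    ((LinearMap.fst _ _ _).prod (LinearMap.snd _ _ _ ∘ₗ LinearMap.snd _ _ _)), ?_, ?_⟩
  · rintro ⟨x', z'⟩
    constructor
    · rintro ⟨y', h1, h2⟩
      exact ⟨(x' - x, y' - y, z' - z), ⟨(hK' _).1 h1, (hL' _).1 h2⟩, rfl⟩
    · rintro ⟨⟨d1, d2, d3⟩, ⟨h1, h2⟩, h3⟩
      obtain ⟨rfl, rfl⟩ : d1 = x' - x ∧ d3 = z' - z := Prod.ext_iff.1 h3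
      exact ⟨y + d2, (hK' _).2 (by simpa [A] using h1), (hL' _).2 (by simpa [B] using h2)⟩
  · intro v v'' α γ hd
    let φ : Module.Dual (ZMod p) (X.Pt × Y.Pt × Z.Pt) :=
      (-X.quantum.form v ∘ₗ LinearMap.fst _ _ _ + α ∘ₗ LinearMap.snd _ _ _) ∘ₗ LinearMap.fst _ _ _ +
      (Z.quantum.form v'' ∘ₗ LinearMap.fst _ _ _ + γ ∘ₗ LinearMap.snd _ _ _) ∘ₗ
        (LinearMap.snd _ _ _ ∘ₗ LinearMap.snd _ _ _)
    have hφ : φ ∈ (A ⊓ B).dualAnnihilator := by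
      rw [Submodule.mem_dualAnnihilator]
      intro w hw
      have := hd (w.1, w.2.2) ⟨w, hw, rfl⟩
      simp only [φ, LinearMap.add_apply, LinearMap.comp_apply, LinearMap.neg_apply,
        LinearMap.fst_apply, LinearMap.snd_apply]
      linear_combination this
    rw [Subspace.dualAnnihilator_inf_eq, Submodule.mem_sup] at hφ
    obtain ⟨f, hf, g, hg, hfg⟩ := hφ
    rw [Submodule.mem_dualAnnihilator] at hf hg
    obtain ⟨u, hu⟩ := Y.quantum.exists_form_eq
      (f ∘ₗ LinearMap.inr _ _ _ ∘ₗ LinearMap.inl _ _ _ ∘ₗ LinearMap.inl _ _ _)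
    let η : Module.Dual (ZMod p) Y.classical.carrier :=
      f ∘ₗ LinearMap.inr _ _ _ ∘ₗ LinearMap.inl _ _ _ ∘ₗ LinearMap.inr _ _ _
    have hsplit (w : X.Pt × Y.Pt × Z.Pt) : f w = f (w.1, 0, 0) + f (0, (w.2.1.1, 0), 0) +
        f (0, (0, w.2.1.2), 0) + f (0, 0, w.2.2) := by
      rw [← map_add, ← map_add, ← map_add]; congr 1; ext <;> simp
    have hf3 (z : Z.Pt) : f (0, 0, z) = 0 := hf _ K.zero_mem
    have hg1 (x : X.Pt) : g (x, 0, 0) = 0 := hg _ L.zero_mem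
    have hfg' (w) : f w + g w = φ w := by rw [← hfg]; rfl
    have m1 : ((v, 0), (u, 0)) ∈ K := h v u α η fun d hd => by
      have e1 := hf (d.1, d.2, 0) hd
      rw [hsplit, hf3] at e1
      have e2 := hfg' (d.1, 0, 0)
      rw [hg1] at e2
      have e3 := hu d.2.1
      simp only [LinearMap.comp_apply, LinearMap.inr_apply, LinearMap.inl_apply] at e3
      simp only [η, LinearMap.comp_apply, LinearMap.inr_apply, LinearMap.inl_apply]
      simp [φ] at e2
      simp only at e1
      linear_combination e1 + e3 - e2
    have m2 : ((u, 0), (v'', 0)) ∈ L := h' u v'' (-η) γ fun d hd => by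
      have e1 := hg (0, d.1, d.2) hd
      have e2 := hfg' (0, d.1, d.2)
      rw [hsplit, hf3, e1] at e2
      have e3 := hu d.1.1
      simp only [LinearMap.comp_apply, LinearMap.inr_apply, LinearMap.inl_apply] at e3
      simp only [η, LinearMap.neg_apply, LinearMap.comp_apply, LinearMap.inr_apply,
        LinearMap.inl_apply]
      have e4 := hf3 d.2
      simp [φ] at e2
      linear_combination e4 - e2 - e3
    exact ⟨((v, 0), (u, 0), (v'', 0)), ⟨m1, m2⟩, rfl⟩

theorem ARQRel.good {p : ℕ} [Fact p.Prime] {X Y : QCSpace p} {R : Set (X.Pt × Y.Pt)}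
    (h : ARQRel p X Y R) : X.Good Y R := by
  induction h with
  | glue X Y R S hR hS => exact QCSpace.good_glue X Y R S hR hS
  | meas => exact QCSpace.good_meas p
  | prep => exact QCSpace.good_converse (QCSpace.good_meas p)
  | comp X Y Z R S _ _ h1 h2 => exact QCSpace.good_comp h1 h2
  | sum X Y X' Y' R S _ _ h1 h2 => exact QCSpace.good_sum h1 h2

theorem exists_symplectic_coordinates (p : ℕ) [Fact p.Prime] (n : ℕ) :
    ∀ (V : Type) [AddCommGroup V] [Module (ZMod p) V] [Module.Finite (ZMod p) V]
      (B : LinearMap.BilinForm (ZMod p) V), B.IsAlt → (∀ v, (∀ w, B v w = 0) → v = 0) →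
      Module.finrank (ZMod p) V = n →
      ∃ (m : ℕ) (e : V →ₗ[ZMod p] (Fin m → ZMod p) × (Fin m → ZMod p)),
        (∀ v w, B v w = stdForm p (Fin m) (e v) (e w)) ∧
        Module.finrank (ZMod p) V = m + m := by
  induction n using Nat.strong_induction_on with
  | _ n ih =>
  intro V _ _ _ B hB hnd hn
  by_cases hV : ∀ v : V, v = 0
  · have : Subsingleton V := ⟨fun a b => by rw [hV a, hV b]⟩
    exact ⟨0, 0, fun v w => by simp [hV v], Module.finrank_zero_of_subsingleton⟩
  push Not at hV
  obtain ⟨v, hv⟩ := hV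
  obtain ⟨w', hw'⟩ : ∃ w, B v w ≠ 0 := by
    by_contra! h
    exact hv (hnd v h)
  obtain ⟨w, hw⟩ : ∃ w, B v w = 1 := ⟨(B v w')⁻¹ • w', by simp [hw']⟩
  have hwv : B w v = -1 := by rw [← hB.neg_eq, hw]
  let U : Submodule (ZMod p) V := LinearMap.ker (B v) ⊓ LinearMap.ker (B w)
  have hU1 (u : U) : B v u = 0 := u.2.1
  have hU2 (u : U) : B w u = 0 := u.2.2
  have hU3 (u : U) : B u v = 0 := by rw [← hB.neg_eq, hU1, neg_zero]
  have hU4 (u : U) : B u w = 0 := by rw [← hB.neg_eq, hU2, neg_zero]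
  let π₀ : V →ₗ[ZMod p] V := LinearMap.id + (B w).smulRight v - (B v).smulRight w
  have hπ₀ (x : V) : π₀ x = x + B w x • v - B v x • w := rfl
  let π : V →ₗ[ZMod p] U := π₀.codRestrict U fun x => by
    constructor <;> simp [hπ₀, hw, hwv, hB.self_eq_zero]
  have hx (x : V) : x = (-B w x) • v + B v x • w + π x := by
    change x = (-B w x) • v + B v x • w + (x + B w x • v - B v x • w)
    module
  have hrank : Module.finrank (ZMod p) V = 2 + Module.finrank (ZMod p) U := by
    let f : V ≃ₗ[ZMod p] (ZMod p × ZMod p) × U :=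
      LinearEquiv.ofBijective (((-B w).prod (B v)).prod π) (by
        constructor
        · rw [injective_iff_map_eq_zero]
          intro x h
          have h1 : -B w x = 0 := congrArg (fun z => z.1.1) h
          have h2 : B v x = 0 := congrArg (fun z => z.1.2) h
          have h3 : π x = 0 := congrArg (fun z => z.2) h
          rw [hx x, h1, h2, h3]; simp
        · rintro ⟨⟨a, b⟩, u⟩
          refine ⟨a • v + b • w + u, Prod.ext (Prod.ext ?_ ?_) (Subtype.ext ?_)⟩
          · simp [hwv, hU2, hB.self_eq_zero]
          · simp [hw, hU1, hB.self_eq_zero]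
          · change π₀ _ = _
            simp [hπ₀, hw, hwv, hU1, hU2, hB.self_eq_zero]
            module)
    rw [f.finrank_eq]; simp
  have hBU : ∀ u u' : U, B.restrict U u u' = B u u' := fun _ _ => rfl
  have key (x y : V) : B x y = (-B w x) * B v y - B v x * (-B w y) + B (π x) (π y) := by
    conv_lhs => rw [hx x, hx y]
    simp [hw, hwv, hU1, hU2, hU3, hU4, hB.self_eq_zero]
  obtain ⟨m, e, he, hm⟩ := ih (Module.finrank (ZMod p) U) (by omega) U (B.restrict U)
    (fun u => hB u) (fun u hu => Subtype.ext (hnd u fun x => by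
      have := hu (π x)
      rw [hx x, map_add, map_add, map_smul, map_smul, hU3, hU4]
      simpa [hBU] using this)) rfl
  refine ⟨m + 1, LinearMap.prod
    (LinearMap.pi (Fin.cons (-B w) fun i => LinearMap.proj i ∘ₗ LinearMap.fst _ _ _ ∘ₗ e ∘ₗ π))
    (LinearMap.pi (Fin.cons (B v) fun i => LinearMap.proj i ∘ₗ LinearMap.snd _ _ _ ∘ₗ e ∘ₗ π)),
    fun x y => ?_, by omega⟩
  rw [key, ← hBU, he, stdForm_apply, stdForm_apply]
  simp [dotProduct, Fin.sum_univ_succ]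
  ring

theorem SympSpace.exists_coordinates {p : ℕ} [Fact p.Prime] (V : SympSpace p) :
    ∃ (m : ℕ) (e : V.carrier ≃ₗ[ZMod p] (Fin m → ZMod p) × (Fin m → ZMod p)),
      ∀ v w, V.form v w = stdForm p (Fin m) (e v) (e w) := by
  obtain ⟨m, e, he, hm⟩ := exists_symplectic_coordinates p _ V.carrier V.form V.alt
    V.nondegenerate.1 rfl
  refine ⟨m, LinearEquiv.ofInjectiveOfFinrankEq e ?_ (by simp [hm]), fun v w => he v w⟩
  rw [injective_iff_map_eq_zero]
  intro x h
  refine V.nondegenerate.1 x fun w => ?_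
  rw [he, h]; simp

/-- The number of qupits represented by a symplectic space. -/
noncomputable def SympSpace.qupits {p : ℕ} [Fact p.Prime] (V : SympSpace p) : ℕ :=
  V.exists_coordinates.choose

/-- A choice of Darboux coordinates. -/
noncomputable def SympSpace.coord {p : ℕ} [Fact p.Prime] (V : SympSpace p) :
    V.carrier ≃ₗ[ZMod p] (Fin V.qupits → ZMod p) × (Fin V.qupits → ZMod p) :=
  V.exists_coordinates.choose_spec.choose

theorem SympSpace.form_eq {p : ℕ} [Fact p.Prime] (V : SympSpace p) (v w : V.carrier) :
    V.form v w = stdForm p (Fin V.qupits) (V.coord v) (V.coord w) :=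
  V.exists_coordinates.choose_spec.choose_spec v w

/-- A choice of linear coordinates on a vector space. -/
noncomputable def VecSpace.coord {p : ℕ} [Fact p.Prime] (W : VecSpace p) :
    W.carrier ≃ₗ[ZMod p] (Fin (Module.finrank (ZMod p) W.carrier) → ZMod p) :=
  (Module.finBasis (ZMod p) W.carrier).equivFun

section Stabiliser

set_option linter.unusedSectionVars false

/-- Operators on the Hilbert space of a finite register `ι` of qupits; the computational basis is
indexed by `ι → F_p`. -/
abbrev Op (p : ℕ) (ι : Type) : Type := Matrix (ι → ZMod p) (ι → ZMod p) ℂ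

/-- The character `ξ(a) = exp (2 π i a / p)`. -/
noncomputable def rootChar (p : ℕ) [Fact p.Prime] : AddChar (ZMod p) ℂ := ZMod.stdAddChar

variable {p : ℕ} [Fact p.Prime] {ι κ σ τ : Type} [Fintype ι] [DecidableEq ι] [Fintype κ]
  [DecidableEq κ] [Fintype σ] [DecidableEq σ] [Fintype τ] [DecidableEq τ]

/-- The Pauli operator `ξ(a) X^x Z^z`, which sends `|j⟩` to `ξ(a + z ⬝ j) |j + x⟩`. -/
noncomputable def pauli (a : ZMod p) (x z : ι → ZMod p) : Op p ι :=
  fun k j => if k = j + x then rootChar p (a + z ⬝ᵥ j) else 0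

/-- Membership in the Pauli group. -/
def IsPauli (P : Op p ι) : Prop := ∃ (a : ZMod p) (x z : ι → ZMod p), P = pauli a x z

/-- Abelian groups of Pauli operators that contain no nontrivial multiple of the identity. -/
def IsPhaseFree (S : Subgroup (Matrix.unitaryGroup (ι → ZMod p) ℂ)) : Prop :=
  (∀ U ∈ S, IsPauli (U : Op p ι)) ∧ (∀ U ∈ S, ∀ V ∈ S, U * V = V * U) ∧
    ∀ U ∈ S, ∀ a : ZMod p, (U : Op p ι) = rootChar p a • (1 : Op p ι) → a = 0

/-- Stabiliser groups: the phase-free Abelian groups of Pauli operators that are maximal. -/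
def IsStabiliserGroup (S : Subgroup (Matrix.unitaryGroup (ι → ZMod p) ℂ)) : Prop :=
  Maximal IsPhaseFree S

/-- Normalised stabiliser states. -/
def IsStabiliserState (ψ : (ι → ZMod p) → ℂ) : Prop :=
  ∃ S : Subgroup (Matrix.unitaryGroup (ι → ZMod p) ℂ), IsStabiliserGroup S ∧
    (∀ U ∈ S, (U : Op p ι).mulVec ψ = ψ) ∧ star ψ ⬝ᵥ ψ = 1

/-- Clifford operators: unitaries that conjugate Pauli operators to Pauli operators. (The two
registers are allowed to be labelled differently.) -/
def IsClifford (U : Matrix (κ → ZMod p) (ι → ZMod p) ℂ) : Prop :=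
  U.conjTranspose * U = 1 ∧ U * U.conjTranspose = 1 ∧
    ∀ P : Op p ι, IsPauli P → IsPauli (U * P * U.conjTranspose)

/-- The tensor product of linear maps, in the computational basis. -/
def tensorMap {ι κ ι' κ' : Type} (f : Matrix (κ → ZMod p) (ι → ZMod p) ℂ)
    (g : Matrix (κ' → ZMod p) (ι' → ZMod p) ℂ) :
    Matrix (κ ⊕ κ' → ZMod p) (ι ⊕ ι' → ZMod p) ℂ :=
  fun y x => f (fun i => y (.inl i)) (fun i => x (.inl i)) *
    g (fun i => y (.inr i)) (fun i => x (.inr i))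

/-- A vector, as a linear map from the Hilbert space of the empty register. -/
def ketMap (ψ : (ι → ZMod p) → ℂ) : Matrix (ι → ZMod p) (Empty → ZMod p) ℂ := fun k _ => ψ k

variable (p) in
/-- The category `Stab_p`: the linear maps generated by stabiliser states, Clifford operators and
the scalars `√p`, `1/√p` under composition, tensor product and adjoint. -/
inductive IsStab : ∀ {ι κ : Type}, Matrix (κ → ZMod p) (ι → ZMod p) ℂ → Prop
  | state {ι : Type} [Fintype ι] [DecidableEq ι] (ψ : (ι → ZMod p) → ℂ)
      (h : IsStabiliserState ψ) : IsStab (ketMap ψ)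
  | clifford {ι κ : Type} [Fintype ι] [DecidableEq ι] [Fintype κ] [DecidableEq κ]
      (U : Matrix (κ → ZMod p) (ι → ZMod p) ℂ) (h : IsClifford U) : IsStab U
  | sqrt : IsStab (((Real.sqrt p : ℝ) : ℂ) • (1 : Op p Empty))
  | invSqrt : IsStab (((Real.sqrt p : ℝ) : ℂ)⁻¹ • (1 : Op p Empty))
  | comp {ι κ σ : Type} [Fintype κ] [DecidableEq κ] (f : Matrix (κ → ZMod p) (ι → ZMod p) ℂ)
      (g : Matrix (σ → ZMod p) (κ → ZMod p) ℂ) : IsStab f → IsStab g → IsStab (g * f)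
  | tensor {ι κ ι' κ' : Type} (f : Matrix (κ → ZMod p) (ι → ZMod p) ℂ)
      (g : Matrix (κ' → ZMod p) (ι' → ZMod p) ℂ) : IsStab f → IsStab g → IsStab (tensorMap f g)
  | adjoint {ι κ : Type} (f : Matrix (κ → ZMod p) (ι → ZMod p) ℂ) :
      IsStab f → IsStab f.conjTranspose

/-- The morphisms of `CPM(Stab_p)`: the class of `f : ι ⊗ σ → κ` with environment `σ` is recorded by
the completely positive map `ρ ↦ f (ρ ⊗ 1) f†`. -/
def IsMixedStab (Φ : Op p ι →ₗ[ℂ] Op p κ) : Prop :=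
  ∃ (σ : Type) (_ : Fintype σ) (_ : DecidableEq σ)
    (f : Matrix (κ → ZMod p) (ι ⊕ σ → ZMod p) ℂ), IsStab p f ∧
      ∀ ρ : Op p ι, Φ ρ = f * tensorMap ρ (1 : Op p σ) * f.conjTranspose

/-! ### Closure properties -/

theorem star_rootChar (a : ZMod p) : star (rootChar p a) = rootChar p (-a) := by
  rw [AddChar.map_neg_eq_conj]; rfl

theorem rootChar_mul (a b : ZMod p) : rootChar p a * rootChar p b = rootChar p (a + b) :=
  (AddChar.map_add_eq_mul _ _ _).symm

theorem rootChar_eq_one {a : ZMod p} (h : rootChar p a = 1) : a = 0 := by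
  have : Function.Injective (ZMod.stdAddChar : AddChar (ZMod p) ℂ) := ZMod.injective_stdAddChar
  exact this (h.trans (AddChar.map_zero_eq_one _).symm)

theorem sum_rootChar (u : ι → ZMod p) :
    ∑ z : ι → ZMod p, rootChar p (z ⬝ᵥ u) = if u = 0 then (p : ℂ) ^ Fintype.card ι else 0 := by
  split_ifs with h
  · subst h; simp [ZMod.card]
  · obtain ⟨i, hi⟩ : ∃ i, u i ≠ 0 := by
      by_contra! h'
      exact h (funext h')
    let φ : AddChar (ι → ZMod p) ℂ := (rootChar p).compAddMonoidHom
      (AddMonoidHom.mk' (fun z : ι → ZMod p => z ⬝ᵥ u) fun a b => add_dotProduct a b u)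
    refine (AddChar.sum_eq_zero_iff_ne_zero (ψ := φ)).2 ?_
    rw [AddChar.ne_zero_iff]
    refine ⟨Pi.single i 1, fun h1 => hi ?_⟩
    have : rootChar p (Pi.single i 1 ⬝ᵥ u) = 1 := h1
    simpa using rootChar_eq_one this

theorem sum_sumArrow {M : Type} [AddCommMonoid M] (F : (ι ⊕ κ → ZMod p) → M) :
    ∑ x, F x = ∑ a : ι → ZMod p, ∑ b : κ → ZMod p, F (Sum.elim a b) := by
  rw [← Fintype.sum_prod_type']
  exact Fintype.sum_equiv (Equiv.sumArrowEquivProdArrow ι κ (ZMod p)) _ _ fun x => by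
    congr 1; ext i; cases i <;> rfl

/-- Relabelling the wires of a register. -/
def relabel (p : ℕ) (e : ι ≃ κ) : Matrix (κ → ZMod p) (ι → ZMod p) ℂ :=
  fun y x => if y = fun i => x (e.symm i) then 1 else 0

theorem relabel_mul (e : ι ≃ κ) (M : Matrix (ι → ZMod p) (σ → ZMod p) ℂ) :
    relabel p e * M = M.submatrix (fun y i => y (e i)) _root_.id := by
  ext y x
  rw [Matrix.submatrix_apply, Matrix.mul_apply, Finset.sum_eq_single (fun i => y (e i))]
  · simp [relabel]
  · intro b _ hb
    rw [relabel, if_neg, zero_mul]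
    rintro rfl
    exact hb (by simp)
  · simp

theorem relabel_conjTranspose (e : ι ≃ κ) :
    (relabel p e).conjTranspose = relabel p e.symm := by
  ext x y
  rw [Matrix.conjTranspose_apply, relabel, relabel]
  have : (y = fun i => x (e.symm i)) ↔ (x = fun i => y (e.symm.symm i)) := by
    constructor <;> rintro rfl <;> simp
  simp [this, apply_ite]

theorem mul_relabel (e : ι ≃ κ) (M : Matrix (σ → ZMod p) (κ → ZMod p) ℂ) :
    M * relabel p e = M.submatrix _root_.id (fun x i => x (e.symm i)) := by
  have := congrArg Matrix.conjTranspose (relabel_mul e.symm M.conjTranspose)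
  rw [Matrix.conjTranspose_mul, relabel_conjTranspose, Matrix.conjTranspose_conjTranspose] at this
  rw [Equiv.symm_symm] at this
  rw [this]
  ext y x
  simp [Matrix.conjTranspose_apply]

theorem isClifford_relabel (e : ι ≃ κ) : IsClifford (relabel p e) := by
  refine ⟨?_, ?_, ?_⟩
  · rw [relabel_conjTranspose, relabel_mul]
    ext x y
    simp only [relabel, Matrix.one_apply, Matrix.submatrix_apply, id]
    congr 1
    refine propext ⟨fun h => ?_, fun h => by rw [h]⟩
    ext i
    simpa using congrFun h (e i)
  · rw [relabel_conjTranspose, relabel_mul]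
    ext x y
    simp only [relabel, Matrix.one_apply, Matrix.submatrix_apply, id]
    congr 1
    refine propext ⟨fun h => ?_, fun h => by rw [h]; simp⟩
    ext i
    simpa using congrFun h (e.symm i)
  · rintro _ ⟨a, x, z, rfl⟩
    refine ⟨a, fun i => x (e.symm i), fun i => z (e.symm i), ?_⟩
    rw [relabel_conjTranspose, mul_relabel, relabel_mul]
    ext k j
    simp only [pauli, Matrix.submatrix_apply, id]
    congr 1
    · refine propext ⟨fun h => ?_, fun h => ?_⟩
      · ext i; simpa using congrFun h (e.symm i)
      · rw [h]; ext i; simp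
    · congr 2
      simp only [dotProduct]
      exact Fintype.sum_equiv e _ _ fun i => by simp

theorem IsStab.relabelled {f : Matrix (κ → ZMod p) (ι → ZMod p) ℂ} (h : IsStab p f)
    (e : ι ≃ σ) (d : κ ≃ τ) :
    IsStab p (f.submatrix (fun (y : τ → ZMod p) i => y (d i)) (fun (x : σ → ZMod p) i => x (e i))) := by
  have h1 := IsStab.comp _ _ (IsStab.comp _ _ (IsStab.clifford _ (isClifford_relabel (p := p) e.symm)) h)
    (IsStab.clifford _ (isClifford_relabel (p := p) d))
  convert h1 using 1
  rw [mul_relabel, relabel_mul]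
  rfl

theorem isStab_one : IsStab p (1 : Op p ι) := by
  have := IsStab.clifford _ (isClifford_relabel (p := p) (Equiv.refl ι))
  convert this using 1
  ext x y
  simp only [relabel, Matrix.one_apply, Equiv.refl_symm, Equiv.refl_apply]
  rfl

theorem IsStab.smul {f : Matrix (κ → ZMod p) (ι → ZMod p) ℂ} (h : IsStab p f) {c : ℂ}
    (hc : IsStab p (c • (1 : Op p Empty))) : IsStab p (c • f) := by
  have := (IsStab.tensor _ _ h hc).relabelled (Equiv.sumEmpty ι Empty) (Equiv.sumEmpty κ Empty)
  convert this using 1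
  refine Matrix.ext fun y x => ?_
  have : (fun i : Empty => y (Equiv.sumEmpty κ Empty (Sum.inr i))) =
      fun i => x (Equiv.sumEmpty ι Empty (Sum.inr i)) := funext fun i => i.elim
  simp [tensorMap, this, mul_comm]

theorem sqrtp_ne_zero : ((Real.sqrt p : ℝ) : ℂ) ≠ 0 := by
  have := (Fact.out : p.Prime).pos
  exact_mod_cast (Real.sqrt_pos.2 (by exact_mod_cast this)).ne'

theorem IsStab.smul_zpow {f : Matrix (κ → ZMod p) (ι → ZMod p) ℂ} (h : IsStab p f) (m : ℤ) :
    IsStab p (((Real.sqrt p : ℝ) : ℂ) ^ m • f) := by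
  induction m using Int.induction_on with
  | zero => simpa using h
  | succ n ih =>
    have := ih.smul .sqrt
    rwa [smul_smul, ← zpow_one_add₀ sqrtp_ne_zero, add_comm] at this
  | pred n ih =>
    have := ih.smul .invSqrt
    rwa [smul_smul, ← zpow_neg_one, ← zpow_add₀ sqrtp_ne_zero, add_comm, ← sub_eq_add_neg] at this

theorem tensorMap_mul {ι κ σ ι' κ' σ' : Type} [Fintype κ] [DecidableEq κ] [Fintype κ']
    [DecidableEq κ'] (f : Matrix (κ → ZMod p) (ι → ZMod p) ℂ)
    (g : Matrix (σ → ZMod p) (κ → ZMod p) ℂ) (f' : Matrix (κ' → ZMod p) (ι' → ZMod p) ℂ)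
    (g' : Matrix (σ' → ZMod p) (κ' → ZMod p) ℂ) :
    tensorMap g g' * tensorMap f f' = tensorMap (g * f) (g' * f') := by
  ext y x
  rw [Matrix.mul_apply, sum_sumArrow]
  simp only [tensorMap, Matrix.mul_apply, Finset.sum_mul_sum, Sum.elim_inl, Sum.elim_inr]
  exact Finset.sum_congr rfl fun _ _ => Finset.sum_congr rfl fun _ _ => by ring

theorem tensorMap_conjTranspose {ι κ ι' κ' : Type} (f : Matrix (κ → ZMod p) (ι → ZMod p) ℂ)
    (g : Matrix (κ' → ZMod p) (ι' → ZMod p) ℂ) :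
    (tensorMap f g).conjTranspose = tensorMap f.conjTranspose g.conjTranspose := by
  ext y x
  simp [tensorMap, Matrix.conjTranspose_apply]

theorem IsMixedStab.comp {Φ : Op p ι →ₗ[ℂ] Op p κ} {Ψ : Op p κ →ₗ[ℂ] Op p τ}
    (hΦ : IsMixedStab Φ) (hΨ : IsMixedStab Ψ) : IsMixedStab (Ψ ∘ₗ Φ) := by
  obtain ⟨σ, _, _, f, hf, hΦ⟩ := hΦ
  obtain ⟨σ', _, _, g, hg, hΨ⟩ := hΨ
  refine ⟨σ ⊕ σ', inferInstance, inferInstance, _, IsStab.comp _ _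
    ((IsStab.tensor _ _ hf (isStab_one (ι := σ'))).relabelled (Equiv.sumAssoc ι σ σ')
      (Equiv.refl _)) hg, fun ρ => ?_⟩
  rw [LinearMap.comp_apply, hΨ, hΦ]
  have h1 : tensorMap (f * tensorMap ρ (1 : Op p σ) * f.conjTranspose) (1 : Op p σ') =
      tensorMap f (1 : Op p σ') * tensorMap (tensorMap ρ (1 : Op p σ)) (1 : Op p σ') *
        (tensorMap f (1 : Op p σ')).conjTranspose := by
    rw [tensorMap_conjTranspose, tensorMap_mul, tensorMap_mul]; simp
  have h2 : (tensorMap f (1 : Op p σ')).submatrix (fun (y : κ ⊕ σ' → ZMod p) i => y ((Equiv.refl _) i))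
      (fun (x : ι ⊕ σ ⊕ σ' → ZMod p) i => x (Equiv.sumAssoc ι σ σ' i)) =
      tensorMap f (1 : Op p σ') * relabel p (Equiv.sumAssoc ι σ σ').symm := by
    rw [mul_relabel]; rfl
  have h3 : relabel p (Equiv.sumAssoc ι σ σ').symm * tensorMap ρ (1 : Op p (σ ⊕ σ')) *
      relabel p (Equiv.sumAssoc ι σ σ') = tensorMap (tensorMap ρ (1 : Op p σ)) (1 : Op p σ') := by
    rw [relabel_mul, mul_relabel]
    ext y x
    simp only [tensorMap, Matrix.one_apply, mul_assoc, Matrix.submatrix_apply, id]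
    congr 1
    simp only [mul_ite, mul_one, mul_zero, ← ite_and]
    congr 1
    refine propext ⟨fun h => ⟨funext fun i => congrFun h (.inr i),
      funext fun i => congrFun h (.inl i)⟩, ?_⟩
    rintro ⟨h', h⟩
    ext i
    rcases i with i | i
    · exact congrFun h i
    · exact congrFun h' i
  rw [h1, h2, Matrix.conjTranspose_mul, Matrix.conjTranspose_mul, relabel_conjTranspose, Equiv.symm_symm, ← h3]
  simp only [Matrix.mul_assoc]

theorem IsMixedStab.smul {Φ : Op p ι →ₗ[ℂ] Op p κ} (hΦ : IsMixedStab Φ) (m : ℤ) :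
    IsMixedStab ((p : ℂ) ^ m • Φ) := by
  obtain ⟨σ, _, _, f, hf, hΦ⟩ := hΦ
  refine ⟨σ, inferInstance, inferInstance, _, hf.smul_zpow m, fun ρ => ?_⟩
  rw [LinearMap.smul_apply, hΦ, Matrix.conjTranspose_smul, Matrix.smul_mul, Matrix.smul_mul,
    Matrix.mul_smul, smul_smul]
  congr 1
  rw [star_zpow₀, ← mul_zpow]
  congr 1
  rw [Complex.star_def, Complex.conj_ofReal, ← Complex.ofReal_mul, Real.mul_self_sqrt (by positivity)]
  simp

end Stabiliser

section PhaseSpace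

set_option linter.unusedSectionVars false

/-- The standard phase space of the register `ι`. -/
abbrev Phase (p : ℕ) (ι : Type) : Type := (ι → ZMod p) × (ι → ZMod p)

variable {p : ℕ} [Fact p.Prime] {ι κ σ τ : Type} [Fintype ι] [DecidableEq ι] [Fintype κ]
  [DecidableEq κ] [Fintype σ] [DecidableEq σ] [Fintype τ] [DecidableEq τ]

/-- The phase-point operator of `(x, z)`: it sends `|j⟩` to `ξ(2 z ⬝ (x - j)) |2 x - j⟩`. -/
noncomputable def phaseOp (v : Phase p ι) : Op p ι :=
  fun k j => if k + j = v.1 + v.1 then rootChar p (v.2 ⬝ᵥ (k - j)) else 0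

/-- The displacement operators: Pauli operators with symmetric phases. -/
noncomputable def disp (b : Phase p ι) : Op p ι := pauli (2⁻¹ * (b.2 ⬝ᵥ b.1)) b.1 b.2

theorem pauli_mul (a a' : ZMod p) (x x' z z' : ι → ZMod p) :
    pauli a x z * pauli a' x' z' = pauli (a + a' + z ⬝ᵥ x') (x + x') (z + z') := by
  ext k j
  rw [Matrix.mul_apply, Finset.sum_eq_single (j + x')]
  · simp only [pauli, if_true]
    by_cases h : k = j + x' + x
    · rw [if_pos h, if_pos (by rw [h]; abel), rootChar_mul]
      congr 1
      rw [dotProduct_add, add_dotProduct]; ring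
    · rw [if_neg h, if_neg (fun h' => h (by rw [h']; abel)), zero_mul]
  · intro b _ hb
    simp [pauli, hb]
  · simp

theorem pauli_zero : pauli (p := p) (ι := ι) 0 0 0 = 1 := by
  ext k j
  simp [pauli, Matrix.one_apply]

theorem pauli_smul (t a : ZMod p) (x z : ι → ZMod p) :
    rootChar p t • pauli a x z = pauli (t + a) x z := by
  ext k j
  simp only [Matrix.smul_apply, pauli, smul_eq_mul, mul_ite, mul_zero, rootChar_mul, add_assoc]

theorem pauli_conjTranspose (a : ZMod p) (x z : ι → ZMod p) :
    (pauli a x z).conjTranspose = pauli (-a + z ⬝ᵥ x) (-x) (-z) := by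
  ext k j
  rw [Matrix.conjTranspose_apply]
  simp only [pauli]
  by_cases h : j = k + x
  · rw [if_pos h, if_pos (by rw [h]; abel), star_rootChar]
    congr 1
    rw [h, dotProduct_add, neg_dotProduct, neg_dotProduct]; ring
  · rw [if_neg h, if_neg (fun h' => h (by rw [h']; abel)), star_zero]

theorem pauli_inj {a a' : ZMod p} {x z : ι → ZMod p} (h : pauli a x z = pauli a' x z) : a = a' := by
  have := congrFun (congrFun h x) 0
  simp only [pauli, zero_add, if_true, dotProduct_zero, add_zero] at this
  exact ZMod.injective_stdAddChar this

theorem half_add {M : Type} [AddCommGroup M] [Module (ZMod p) M] (h2 : (2 : ZMod p) ≠ 0) (x : M) :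
    (2⁻¹ : ZMod p) • x + (2⁻¹ : ZMod p) • x = x := by
  rw [← add_smul, ← two_mul, mul_inv_cancel₀ h2, one_smul]

theorem disp_mul_phaseOp (h2 : (2 : ZMod p) ≠ 0) (b v : Phase p ι) :
    disp b * phaseOp v = rootChar p (stdForm p ι v b) • phaseOp (v + (2⁻¹ : ZMod p) • b) := by
  ext k j
  rw [Matrix.mul_apply, Finset.sum_eq_single (k - b.1)]
  · simp only [disp, pauli, phaseOp, sub_add_cancel, if_true, Matrix.smul_apply, smul_eq_mul,
      Prod.fst_add, Prod.snd_add, Prod.smul_fst, Prod.smul_snd]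
    have e : v.1 + (2⁻¹ : ZMod p) • b.1 + (v.1 + (2⁻¹ : ZMod p) • b.1) = v.1 + v.1 + b.1 := by
      conv_rhs => rw [← half_add h2 b.1]
      abel
    rw [e]
    by_cases h : k + j = v.1 + v.1 + b.1
    · rw [if_pos h, if_pos (by rw [sub_add_eq_add_sub, h]; abel), rootChar_mul, rootChar_mul]
      congr 1
      have hk : b.2 ⬝ᵥ k + b.2 ⬝ᵥ j = b.2 ⬝ᵥ v.1 + b.2 ⬝ᵥ v.1 + b.2 ⬝ᵥ b.1 := by
        rw [← dotProduct_add, h]; simp only [dotProduct_add]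
      rw [stdForm_apply]
      simp only [dotProduct_sub, add_dotProduct, smul_dotProduct, smul_eq_mul,
        dotProduct_comm v.1 b.2]
      field_simp
      linear_combination hk
    · rw [if_neg h, if_neg, mul_zero, mul_zero]
      intro h'
      apply h
      rw [← h']; abel
  · intro c _ hc
    simp only [disp, pauli]
    rw [if_neg, zero_mul]
    rintro rfl
    simp at hc
  · simp

theorem phaseOp_mul_disp (h2 : (2 : ZMod p) ≠ 0) (b v : Phase p ι) :
    phaseOp v * disp b = rootChar p (stdForm p ι v b) • phaseOp (v - (2⁻¹ : ZMod p) • b) := by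
  ext k j
  rw [Matrix.mul_apply, Finset.sum_eq_single (j + b.1)]
  · simp only [disp, pauli, phaseOp, if_true, Matrix.smul_apply, smul_eq_mul,
      Prod.fst_sub, Prod.snd_sub, Prod.smul_fst, Prod.smul_snd]
    have e : v.1 - (2⁻¹ : ZMod p) • b.1 + (v.1 - (2⁻¹ : ZMod p) • b.1) = v.1 + v.1 - b.1 := by
      conv_rhs => rw [← half_add h2 b.1]
      abel
    rw [e]
    by_cases h : k + j = v.1 + v.1 - b.1
    · rw [if_pos h, if_pos (by rw [← add_assoc, h]; abel), rootChar_mul, rootChar_mul]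
      congr 1
      have hk : b.2 ⬝ᵥ k + b.2 ⬝ᵥ j = b.2 ⬝ᵥ v.1 + b.2 ⬝ᵥ v.1 - b.2 ⬝ᵥ b.1 := by
        rw [← dotProduct_add, h]; simp only [dotProduct_add, dotProduct_sub]
      rw [stdForm_apply]
      simp only [dotProduct_sub, dotProduct_add, sub_dotProduct, smul_dotProduct, smul_eq_mul,
        dotProduct_comm v.1 b.2]
      field_simp
      linear_combination hk
    · rw [if_neg h, if_neg, zero_mul, mul_zero]
      intro h'
      apply h
      rw [← h']; abel
  · intro c _ hc
    simp only [disp, pauli]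
    rw [if_neg hc, mul_zero]
  · simp

theorem disp_mul_disp (h2 : (2 : ZMod p) ≠ 0) (b c : Phase p ι) :
    disp b * disp c = rootChar p (-(2⁻¹ * stdForm p ι b c)) • disp (b + c) := by
  rw [disp, disp, disp, pauli_mul, pauli_smul]
  congr 1
  rw [stdForm_apply]
  simp only [Prod.fst_add, Prod.snd_add, dotProduct_add, add_dotProduct, dotProduct_comm b.1 c.2]
  field_simp
  ring

theorem disp_zero : disp (0 : Phase p ι) = 1 := by
  simp [disp, pauli_zero]

theorem disp_transpose (b : Phase p ι) (h2 : (2 : ZMod p) ≠ 0) :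
    (disp (b.1, -b.2)).transpose = disp (-b) := by
  ext k j
  simp only [Matrix.transpose_apply, disp, pauli, Prod.fst_neg, Prod.snd_neg]
  by_cases h : j = k + b.1
  · rw [if_pos h, if_pos (by rw [h]; abel)]
    congr 1
    rw [h]
    simp only [neg_dotProduct, dotProduct_neg, dotProduct_add]
    field_simp
    ring
  · rw [if_neg h, if_neg (fun h' => h (by rw [h']; abel))]

theorem phaseOp_conjTranspose (v : Phase p ι) : (phaseOp v).conjTranspose = phaseOp v := by
  ext k j
  rw [Matrix.conjTranspose_apply]
  simp only [phaseOp, add_comm j k, apply_ite star, star_zero, star_rootChar]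
  congr 2
  rw [← dotProduct_neg, neg_sub]

theorem phaseOp_trace (h2 : (2 : ZMod p) ≠ 0) (v : Phase p ι) : (phaseOp v).trace = 1 := by
  rw [Matrix.trace, Finset.sum_eq_single v.1]
  · simp [phaseOp]
  · intro k _ hk
    rw [Matrix.diag_apply, phaseOp, if_neg]
    intro h
    apply hk
    rw [← two_smul (ZMod p) k, ← two_smul (ZMod p) v.1] at h
    exact smul_right_injective _ h2 h
  · simp

theorem p_ne_zero : (p : ℂ) ≠ 0 := by
  exact_mod_cast (Fact.out : p.Prime).ne_zero

theorem phaseOp_fourier (h2 : (2 : ZMod p) ≠ 0) (v : Phase p ι) :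
    (p : ℂ) ^ Fintype.card ι • phaseOp v =
      ∑ b : Phase p ι, rootChar p (-stdForm p ι v b) • disp b := by
  ext k j
  rw [Matrix.sum_apply, Fintype.sum_prod_type, Finset.sum_eq_single (k - j)]
  · simp only [Matrix.smul_apply, disp, pauli, add_sub_cancel, if_true, smul_eq_mul, rootChar_mul,
      stdForm_apply, phaseOp]
    have e (z : ι → ZMod p) : -(v.1 ⬝ᵥ z - v.2 ⬝ᵥ (k - j)) + (2⁻¹ * z ⬝ᵥ (k - j) + z ⬝ᵥ j) =
        v.2 ⬝ᵥ (k - j) + z ⬝ᵥ ((2⁻¹ : ZMod p) • (k + j) - v.1) := by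
      simp only [dotProduct_sub, dotProduct_add, dotProduct_smul, smul_eq_mul, dotProduct_comm v.1 z]
      field_simp
      ring
    simp only [e, ← rootChar_mul, ← Finset.mul_sum, sum_rootChar]
    have : (k + j = v.1 + v.1) ↔ ((2⁻¹ : ZMod p) • (k + j) - v.1 = 0) := by
      rw [sub_eq_zero]
      constructor
      · intro h; rw [h, smul_add, half_add h2]
      · intro h; rw [← half_add h2 (k + j), h]
    simp only [this]
    split_ifs <;> ring
  · intro x _ hx
    refine Finset.sum_eq_zero fun z _ => ?_
    simp only [Matrix.smul_apply, disp, pauli]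
    rw [if_neg, smul_zero]
    rintro rfl
    simp at hx
  · simp

open Classical in
/-- The sum of the phase-point operators over a subset of phase space. -/
noncomputable def phaseSum (C : Set (Phase p ι)) : Op p ι :=
  ∑ v : Phase p ι, if v ∈ C then phaseOp v else 0

theorem phaseSum_conjTranspose (C : Set (Phase p ι)) :
    (phaseSum C).conjTranspose = phaseSum C := by
  classical
  rw [phaseSum, Matrix.conjTranspose_sum]
  exact Finset.sum_congr rfl fun v _ => by split_ifs <;> simp [phaseOp_conjTranspose]

section Coset

variable {C : Set (Phase p ι)} {a : Phase p ι} {K : Submodule (ZMod p) (Phase p ι)}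

theorem IsCoset.add_mem_iff (hC : IsCoset C a K) {b : Phase p ι} (hb : b ∈ K) (v : Phase p ι) :
    v + b ∈ C ↔ v ∈ C := by
  rw [hC, hC, add_sub_right_comm]
  exact ⟨fun h => by simpa using K.sub_mem h hb, fun h => K.add_mem h hb⟩

theorem IsCoset.card (hC : IsCoset C a K) : Nat.card C = Nat.card K :=
  Nat.card_congr ((Equiv.subRight a).subtypeEquiv fun x => hC x)

theorem disp_mul_phaseSum (h2 : (2 : ZMod p) ≠ 0) (hC : IsCoset C a K)
    (hK : (stdForm p ι).orthogonal K ≤ K) {b : Phase p ι} (hb : b ∈ (stdForm p ι).orthogonal K) :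
    disp b * phaseSum C = rootChar p (stdForm p ι a b) • phaseSum C := by
  classical
  rw [phaseSum, Finset.mul_sum, Finset.smul_sum]
  refine Fintype.sum_equiv (Equiv.addRight ((2⁻¹ : ZMod p) • b)) _ _ fun v => ?_
  simp only [Equiv.coe_addRight, hC.add_mem_iff (K.smul_mem _ (hK hb))]
  split_ifs with h
  · rw [disp_mul_phaseOp h2]
    have : stdForm p ι (v - a) b = 0 := hb _ ((hC v).1 h)
    rw [map_sub, LinearMap.sub_apply, sub_eq_zero] at this
    rw [this]
  · simp

theorem disp_comm_phaseSum (h2 : (2 : ZMod p) ≠ 0) (hC : IsCoset C a K) {b : Phase p ι}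
    (hb : b ∈ K) : disp b * phaseSum C = phaseSum C * disp b := by
  classical
  rw [phaseSum, Finset.mul_sum, Finset.sum_mul]
  refine Fintype.sum_equiv (Equiv.addRight b) _ _ fun v => ?_
  simp only [Equiv.coe_addRight, hC.add_mem_iff hb]
  split_ifs with h
  · rw [disp_mul_phaseOp h2, phaseOp_mul_disp h2, map_add, LinearMap.add_apply, stdForm_isAlt,
      add_zero]
    congr 2
    conv_rhs => rw [← half_add h2 b]
    rw [half_add h2 b]
    nth_rw 2 [← half_add h2 b]
    abel
  · simp

open Classical in
theorem sum_coset_rootChar (hC : IsCoset C a K) (b : Phase p ι) :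
    (∑ v : Phase p ι, if v ∈ C then rootChar p (-stdForm p ι v b) else 0) =
      if b ∈ (stdForm p ι).orthogonal K then
        (Nat.card K : ℂ) * rootChar p (-stdForm p ι a b) else 0 := by
  split_ifs with hb
  · have : ∀ v : Phase p ι, (if v ∈ C then rootChar p (-stdForm p ι v b) else 0) =
        (if v ∈ C then 1 else 0) * rootChar p (-stdForm p ι a b) := fun v => by
      split_ifs with h
      · have : stdForm p ι (v - a) b = 0 := hb _ ((hC v).1 h)
        rw [map_sub, LinearMap.sub_apply, sub_eq_zero] at this
        rw [this, one_mul]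
      · simp
    rw [Finset.sum_congr rfl fun v _ => this v, ← Finset.sum_mul, ← hC.card, Finset.sum_boole,
      Nat.card_eq_fintype_card, Fintype.card_subtype]
  · obtain ⟨d, hd, hdb⟩ : ∃ d ∈ K, stdForm p ι d b ≠ 0 := by
      by_contra! h
      exact hb h
    set s := ∑ v : Phase p ι, if v ∈ C then rootChar p (-stdForm p ι v b) else 0 with hs
    have h1 : s = rootChar p (-stdForm p ι d b) * s := by
      conv_lhs => rw [hs]
      rw [hs, Finset.mul_sum]
      symm
      refine Fintype.sum_equiv (Equiv.addRight d) _ _ fun v => ?_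
      simp only [Equiv.coe_addRight, hC.add_mem_iff hd]
      split_ifs
      · rw [rootChar_mul, map_add (stdForm p ι), LinearMap.add_apply]; congr 1; ring
      · simp
    have h3 : (rootChar p (-stdForm p ι d b) - 1) * s = 0 := by linear_combination -h1
    rcases mul_eq_zero.1 h3 with h | h
    · exact absurd (rootChar_eq_one (sub_eq_zero.1 h)) (neg_ne_zero.2 hdb)
    · exact h

open Classical in
theorem phaseSum_eq (h2 : (2 : ZMod p) ≠ 0) (hC : IsCoset C a K) :
    (p : ℂ) ^ Fintype.card ι • phaseSum C = ∑ b : Phase p ι,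
      if b ∈ (stdForm p ι).orthogonal K then
        ((Nat.card K : ℂ) * rootChar p (-stdForm p ι a b)) • disp b else 0 := by
  rw [phaseSum, Finset.smul_sum]
  have (v : Phase p ι) : (p : ℂ) ^ Fintype.card ι • (if v ∈ C then phaseOp v else 0) =
      ∑ b : Phase p ι, (if v ∈ C then rootChar p (-stdForm p ι v b) else 0) • disp b := by
    split_ifs
    · rw [phaseOp_fourier h2]
    · simp
  rw [Finset.sum_congr rfl fun v _ => this v, Finset.sum_comm]
  refine Finset.sum_congr rfl fun b _ => ?_
  rw [← Finset.sum_smul, sum_coset_rootChar hC]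
  split_ifs <;> simp

theorem phaseSum_mul_self (h2 : (2 : ZMod p) ≠ 0) (hC : IsCoset C a K)
    (hK : (stdForm p ι).orthogonal K ≤ K) :
    ∃ m : ℤ, phaseSum C * phaseSum C = (p : ℂ) ^ m • phaseSum C := by
  classical
  have h1 : (p : ℂ) ^ Fintype.card ι • (phaseSum C * phaseSum C) =
      ((Nat.card K : ℂ) * (Nat.card ((stdForm p ι).orthogonal K) : ℂ)) • phaseSum C := by
    rw [← Matrix.smul_mul, phaseSum_eq h2 hC, Finset.sum_mul]
    have (b : Phase p ι) : (if b ∈ (stdForm p ι).orthogonal K then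
        ((Nat.card K : ℂ) * rootChar p (-stdForm p ι a b)) • disp b else 0) * phaseSum C =
        (if b ∈ (stdForm p ι).orthogonal K then (1 : ℂ) else 0) •
          ((Nat.card K : ℂ) • phaseSum C) := by
      split_ifs with hb
      · rw [Matrix.smul_mul, disp_mul_phaseSum h2 hC hK hb, smul_smul, mul_assoc, rootChar_mul]
        simp
      · simp
    rw [Finset.sum_congr rfl fun b _ => this b, ← Finset.sum_smul, Finset.sum_boole, smul_smul,
      mul_comm]
    congr 3
    rw [Nat.card_eq_fintype_card, Fintype.card_subtype]
  have e1 := Module.card_eq_pow_finrank (K := ZMod p) (V := K)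
  have e2 := Module.card_eq_pow_finrank (K := ZMod p) (V := (stdForm p ι).orthogonal K)
  refine ⟨(Module.finrank (ZMod p) K : ℤ) + Module.finrank (ZMod p) ((stdForm p ι).orthogonal K) -
    Fintype.card ι, ?_⟩
  rw [zpow_sub₀ p_ne_zero, zpow_add₀ p_ne_zero]
  rw [Nat.card_eq_fintype_card, Nat.card_eq_fintype_card, e1, e2, ZMod.card] at h1
  have h3 : (p : ℂ) ^ Fintype.card ι ≠ 0 := pow_ne_zero _ p_ne_zero
  rw [← smul_right_inj h3, h1, smul_smul]
  congr 1
  push_cast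
  simp only [zpow_natCast]
  field_simp

theorem phaseSum_trace (h2 : (2 : ZMod p) ≠ 0) (hC : IsCoset C a K) :
    (phaseSum C).trace = (p : ℂ) ^ Module.finrank (ZMod p) K := by
  classical
  rw [phaseSum, Matrix.trace_sum]
  have (v : Phase p ι) : (if v ∈ C then phaseOp v else 0).trace = if v ∈ C then (1 : ℂ) else 0 := by
    split_ifs
    · exact phaseOp_trace h2 v
    · simp
  rw [Finset.sum_congr rfl fun v _ => this v, Finset.sum_boole]
  have e1 := Module.card_eq_pow_finrank (K := ZMod p) (V := K)
  rw [ZMod.card, ← Nat.card_eq_fintype_card, ← hC.card, Nat.card_eq_fintype_card,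
    Fintype.card_subtype] at e1
  rw [← Nat.cast_pow, ← e1]

end Coset

end PhaseSpace

section Dilation

set_option linter.unusedSectionVars false

variable {p : ℕ} [Fact p.Prime] {ι κ σ τ : Type} [Fintype ι] [DecidableEq ι] [Fintype κ]
  [DecidableEq κ] [Fintype σ] [DecidableEq σ] [Fintype τ] [DecidableEq τ]

/-- The vector in a doubled register with the same entries as an operator. -/
def vecOp (M : Op p ι) : (ι ⊕ ι → ZMod p) → ℂ :=
  fun w => M (fun i => w (.inl i)) fun i => w (.inr i)

theorem tensorMap_mulVec_vecOp (A B M : Op p ι) :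
    (tensorMap A B).mulVec (vecOp M) = vecOp (A * M * B.transpose) := by
  ext w
  simp only [Matrix.mulVec, dotProduct, tensorMap, vecOp, Matrix.mul_apply, Matrix.transpose_apply]
  rw [sum_sumArrow, Finset.sum_comm]
  simp only [Sum.elim_inl, Sum.elim_inr, Finset.sum_mul]
  exact Finset.sum_congr rfl fun _ _ => Finset.sum_congr rfl fun _ _ => by ring

theorem tensorMap_disp (b c : Phase p ι) :
    tensorMap (disp b) (disp c) = disp (Sum.elim b.1 c.1, Sum.elim b.2 c.2) := by
  ext k j
  simp only [tensorMap, disp, pauli]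
  have e1 : (k = j + Sum.elim b.1 c.1) ↔
      ((fun i => k (.inl i)) = (fun i => j (.inl i)) + b.1) ∧
        ((fun i => k (.inr i)) = (fun i => j (.inr i)) + c.1) := by
    constructor
    · rintro rfl; exact ⟨rfl, rfl⟩
    · rintro ⟨h1, h2⟩
      ext i
      rcases i with i | i
      · exact congrFun h1 i
      · exact congrFun h2 i
  simp only [e1, ite_mul, mul_ite, zero_mul, mul_zero, ite_and]
  split_ifs
  · rw [rootChar_mul]
    congr 1
    simp only [dotProduct, Fintype.sum_sum_type, Sum.elim_inl, Sum.elim_inr]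
    ring
  all_goals rfl

theorem isPauli_mul {P Q : Op p ι} (hP : IsPauli P) (hQ : IsPauli Q) : IsPauli (P * Q) := by
  obtain ⟨a, x, z, rfl⟩ := hP
  obtain ⟨a', x', z', rfl⟩ := hQ
  exact ⟨_, _, _, pauli_mul _ _ _ _ _ _⟩

theorem isPauli_star {P : Op p ι} (hP : IsPauli P) : IsPauli P.conjTranspose := by
  obtain ⟨a, x, z, rfl⟩ := hP
  exact ⟨_, _, _, pauli_conjTranspose _ _ _⟩

theorem pauli_mem_unitary (a : ZMod p) (x z : ι → ZMod p) :
    pauli a x z ∈ Matrix.unitaryGroup (ι → ZMod p) ℂ := by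
  rw [Matrix.mem_unitaryGroup_iff, Matrix.star_eq_conjTranspose, pauli_conjTranspose, pauli_mul]
  rw [← pauli_zero]
  congr 1
  · rw [dotProduct_neg]; ring
  · simp
  · simp

/-- The Pauli operators that fix a given vector. -/
def fixingPaulis (ψ : (ι → ZMod p) → ℂ) : Subgroup (Matrix.unitaryGroup (ι → ZMod p) ℂ) where
  carrier := {U | IsPauli (U : Op p ι) ∧ (U : Op p ι).mulVec ψ = ψ}
  mul_mem' := fun {U V} hU hV => ⟨isPauli_mul hU.1 hV.1, by
    rw [Submonoid.coe_mul, ← Matrix.mulVec_mulVec, hV.2, hU.2]⟩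
  one_mem' := ⟨⟨0, 0, 0, pauli_zero.symm⟩, Matrix.one_mulVec _⟩
  inv_mem' := fun {U} hU => ⟨isPauli_star hU.1, by
    have h : ((U⁻¹ * U : Matrix.unitaryGroup (ι → ZMod p) ℂ) : Op p ι) = 1 := by
      rw [inv_mul_cancel]; rfl
    have h' : (U⁻¹ : Matrix.unitaryGroup (ι → ZMod p) ℂ).1 * U.1 = 1 := h
    conv_lhs => rw [← hU.2]
    rw [Matrix.mulVec_mulVec, h', Matrix.one_mulVec]⟩

theorem pauli_comm (a a' : ZMod p) (b c : Phase p ι) :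
    pauli a b.1 b.2 * pauli a' c.1 c.2 =
      rootChar p (-stdForm p ι b c) • (pauli a' c.1 c.2 * pauli a b.1 b.2) := by
  rw [pauli_mul, pauli_mul, pauli_smul, stdForm_apply, add_comm c.1, add_comm c.2]
  congr 1
  rw [dotProduct_comm b.1]; ring

theorem smul_eq_self_of_rootChar {ψ : (ι → ZMod p) → ℂ} (hψ : ψ ≠ 0) {t : ZMod p}
    (h : rootChar p t • ψ = ψ) : t = 0 := by
  obtain ⟨i, hi⟩ := Function.ne_iff.1 hψ
  have := congrFun h i
  simp only [Pi.smul_apply, smul_eq_mul] at this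
  exact rootChar_eq_one (mul_right_cancel₀ hi (by rw [this, one_mul]))

theorem fixingPaulis_phaseFree {ψ : (ι → ZMod p) → ℂ} (hψ : ψ ≠ 0) :
    IsPhaseFree (fixingPaulis ψ) := by
  refine ⟨fun U hU => hU.1, fun U hU V hV => ?_, fun U hU a ha => ?_⟩
  · obtain ⟨⟨a, x, z, hU1⟩, hU2⟩ := hU
    obtain ⟨⟨a', x', z', hV1⟩, hV2⟩ := hV
    have h := pauli_comm a a' (x, z) (x', z')
    simp only [← hU1, ← hV1] at h
    have h1 := congrArg (fun M : Op p ι => M.mulVec ψ) h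
    simp only [Matrix.smul_mulVec, ← Matrix.mulVec_mulVec, hU2, hV2] at h1
    rw [smul_eq_self_of_rootChar hψ h1.symm] at h
    refine Subtype.ext ?_
    simpa using h
  · have h1 := hU.2
    rw [ha, Matrix.smul_mulVec, Matrix.one_mulVec] at h1
    exact smul_eq_self_of_rootChar hψ h1

variable {C : Set (Phase p ι)} {a : Phase p ι} {K : Submodule (ZMod p) (Phase p ι)}

theorem exists_pauli_fix (h2 : (2 : ZMod p) ≠ 0) (hC : IsCoset C a K)
    (hK : (stdForm p ι).orthogonal K ≤ K) {b c : Phase p ι} (hc : c ∈ K)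
    (hbc : b - c ∈ (stdForm p ι).orthogonal K) :
    ∃ t, (pauli t (Sum.elim b.1 c.1) (Sum.elim b.2 (-c.2))).mulVec (vecOp (phaseSum C)) =
      vecOp (phaseSum C) := by
  have h1 : disp b * phaseSum C * disp (-c) = rootChar p (-(2⁻¹ * stdForm p ι b (-c)) +
      stdForm p ι a (b - c)) • phaseSum C := by
    rw [Matrix.mul_assoc, ← disp_comm_phaseSum h2 hC (K.neg_mem hc), ← Matrix.mul_assoc,
      disp_mul_disp h2, Matrix.smul_mul, ← sub_eq_add_neg, disp_mul_phaseSum h2 hC hK hbc,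
      smul_smul, rootChar_mul]
  set s := -(2⁻¹ * stdForm p ι b (-c)) + stdForm p ι a (b - c)
  have h3 := tensorMap_disp b (c.1, -c.2)
  have h4 := tensorMap_mulVec_vecOp (disp b) (disp (c.1, -c.2)) (phaseSum C)
  rw [disp_transpose c h2, h1, h3, disp] at h4
  refine ⟨-s + 2⁻¹ * (Sum.elim b.2 (-c.2) ⬝ᵥ Sum.elim b.1 c.1), ?_⟩
  rw [← pauli_smul, Matrix.smul_mulVec]
  simp only at h4
  rw [h4]
  ext w
  simp only [Pi.smul_apply, vecOp, Matrix.smul_apply, smul_eq_mul, ← mul_assoc, rootChar_mul]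
  simp

theorem stdForm_sum (b c : Phase p (ι ⊕ κ)) :
    stdForm p (ι ⊕ κ) b c =
      stdForm p ι (fun i => b.1 (.inl i), fun i => b.2 (.inl i))
        (fun i => c.1 (.inl i), fun i => c.2 (.inl i)) +
      stdForm p κ (fun i => b.1 (.inr i), fun i => b.2 (.inr i))
        (fun i => c.1 (.inr i), fun i => c.2 (.inr i)) := by
  simp only [stdForm_apply, dotProduct, Fintype.sum_sum_type]
  ring

theorem isStab_vecOp (h2 : (2 : ZMod p) ≠ 0) (hC : IsCoset C a K)
    (hK : (stdForm p ι).orthogonal K ≤ K) : IsStab p (ketMap (vecOp (phaseSum C))) := by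
  obtain ⟨m, hm⟩ := phaseSum_mul_self h2 hC hK
  set k := Module.finrank (ZMod p) K
  set T := phaseSum C with hT
  have hTT : T.conjTranspose = T := phaseSum_conjTranspose C
  have hnorm : star (vecOp T) ⬝ᵥ vecOp T = (p : ℂ) ^ (m + k) := by
    have h1 : star (vecOp T) ⬝ᵥ vecOp T = (T * T).trace := by
      conv_rhs => enter [1, 1]; rw [← hTT]
      rw [dotProduct, sum_sumArrow, Matrix.trace, Finset.sum_comm]
      simp only [Matrix.diag_apply, Matrix.mul_apply, Matrix.conjTranspose_apply]
      rfl
    rw [h1, hm, Matrix.trace_smul, hT, phaseSum_trace h2 hC, smul_eq_mul, zpow_add₀ p_ne_zero,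
      zpow_natCast]
  have hs : ((Real.sqrt p : ℝ) : ℂ) * ((Real.sqrt p : ℝ) : ℂ) = p := by
    rw [← Complex.ofReal_mul, Real.mul_self_sqrt (by positivity)]; simp
  set c : ℂ := ((Real.sqrt p : ℝ) : ℂ) ^ (-(m + k)) with hc
  have hcc : star c * c * (p : ℂ) ^ (m + k) = 1 := by
    have : star c = c := by
      rw [hc, star_zpow₀, Complex.star_def, Complex.conj_ofReal]
    rw [this, hc, ← mul_zpow, hs, ← zpow_add₀ p_ne_zero]; simp
  have hc0 : c ≠ 0 := zpow_ne_zero _ sqrtp_ne_zero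
  have hψ0 : vecOp T ≠ 0 := by
    intro h
    rw [h] at hnorm
    simp only [star_zero, zero_dotProduct] at hnorm
    exact zpow_ne_zero _ p_ne_zero hnorm.symm
  have key : IsStabiliserState (c • vecOp T) := by
    refine ⟨fixingPaulis (vecOp T), ⟨fixingPaulis_phaseFree hψ0, ?_⟩, ?_, ?_⟩
    · intro S' hS' hle U hU
      obtain ⟨t, x, z, hUx⟩ := hS'.1 U hU
      set b₁ : Phase p ι := (fun i => x (.inl i), fun i => z (.inl i)) with hb₁
      set b₂ : Phase p ι := (fun i => x (.inr i), fun i => -z (.inr i)) with hb₂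
      have hx : x = Sum.elim b₁.1 b₂.1 := by ext i; cases i <;> rfl
      have hz : z = Sum.elim b₁.2 (-b₂.2) := by ext i; cases i <;> simp [hb₁, hb₂]
      have comm : ∀ c₁ c₂ : Phase p ι, c₂ ∈ K → c₁ - c₂ ∈ (stdForm p ι).orthogonal K →
          stdForm p ι c₁ b₁ = stdForm p ι c₂ b₂ := by
        intro c₁ c₂ hc₂ hc₁₂
        obtain ⟨s, hs⟩ := exists_pauli_fix h2 hC hK hc₂ hc₁₂
        let V : Matrix.unitaryGroup (ι ⊕ ι → ZMod p) ℂ :=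
          ⟨pauli s (Sum.elim c₁.1 c₂.1) (Sum.elim c₁.2 (-c₂.2)), pauli_mem_unitary _ _ _⟩
        have hV : V ∈ S' := hle ⟨⟨_, _, _, rfl⟩, hs⟩
        have hUV := congrArg (Subtype.val : _ → Op p (ι ⊕ ι)) (hS'.2.1 V hV U hU)
        have h5 := pauli_comm s t (Sum.elim c₁.1 c₂.1, Sum.elim c₁.2 (-c₂.2)) (x, z)
        simp only [Submonoid.coe_mul, hUx] at hUV
        change pauli s _ _ * pauli t x z = pauli t x z * pauli s _ _ at hUV
        simp only at h5
        rw [hUV, pauli_mul, pauli_smul] at h5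
        have h6 := pauli_inj h5
        have h7 : stdForm p (ι ⊕ ι) (Sum.elim c₁.1 c₂.1, Sum.elim c₁.2 (-c₂.2)) (x, z) = 0 := by
          linear_combination h6
        rw [stdForm_sum] at h7
        simp only [stdForm_apply, Sum.elim_inl, Sum.elim_inr, hb₁, hb₂] at h7 ⊢
        have e1 : (fun i => (-c₂.2) i) = -c₂.2 := rfl
        have e2 : (fun i => -z (Sum.inr i)) = -fun i => z (Sum.inr i) := rfl
        rw [e1, neg_dotProduct] at h7
        rw [e2, dotProduct_neg]
        linear_combination h7
      have hrefl := (stdForm_isAlt p ι).isRefl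
      have m1 : b₁ - b₂ ∈ (stdForm p ι).orthogonal K := fun d hd => by
        change stdForm p ι d (b₁ - b₂) = 0
        rw [map_sub, sub_eq_zero]
        exact comm d d hd (by simp)
      have m2 : b₁ ∈ K := by
        rw [← LinearMap.BilinForm.orthogonal_orthogonal (stdForm_nondegenerate p ι) hrefl K]
        intro d hd
        have := comm d 0 K.zero_mem (by simpa using hd)
        simpa using this
      have m3 : b₂ ∈ K := by
        have := K.sub_mem m2 (hK m1)
        simpa using this
      obtain ⟨s, hs⟩ := exists_pauli_fix h2 hC hK m3 m1
      rw [← hx, ← hz] at hs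
      let V : Matrix.unitaryGroup (ι ⊕ ι → ZMod p) ℂ := ⟨_, pauli_mem_unitary s x z⟩
      have hV : V ∈ fixingPaulis (vecOp T) := ⟨⟨_, _, _, rfl⟩, hs⟩
      have hUV : (U : Op p (ι ⊕ ι)) = rootChar p (t - s) • (V : Op p (ι ⊕ ι)) := by
        change _ = _ • pauli s x z
        rw [hUx, pauli_smul]; simp
      have h8 : t - s = 0 := by
        refine hS'.2.2 (U * V⁻¹) (S'.mul_mem hU (S'.inv_mem (hle hV))) _ ?_
        have h9 : (V : Op p (ι ⊕ ι)) * (V⁻¹ : Matrix.unitaryGroup (ι ⊕ ι → ZMod p) ℂ).1 = 1 := by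
          rw [← Submonoid.coe_mul, mul_inv_cancel]; rfl
        rw [Submonoid.coe_mul, hUV, Matrix.smul_mul, h9]
      rw [h8] at hUV
      have : U = V := Subtype.ext (by simpa using hUV)
      rw [this]
      exact hV
    · intro U hU
      rw [Matrix.mulVec_smul, hU.2]
    · rw [star_smul, smul_dotProduct, dotProduct_smul, hnorm]
      simp only [smul_eq_mul]
      rw [← mul_assoc, hcc]
  have h := (IsStab.state _ key).smul_zpow (m + k)
  convert h using 1
  ext w e
  simp only [ketMap, Matrix.smul_apply, Pi.smul_apply, smul_eq_mul, hc, ← mul_assoc]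
  rw [← zpow_add₀ sqrtp_ne_zero]; simp

theorem isStab_bell (h2 : (2 : ZMod p) ≠ 0) : IsStab p (ketMap (vecOp (1 : Op p ι))) := by
  classical
  have hC : IsCoset (Set.univ : Set (Phase p ι)) 0 (⊤ : Submodule (ZMod p) (Phase p ι)) := fun x => by simp
  have h := isStab_vecOp h2 hC le_top
  have hbot : (stdForm p ι).orthogonal ⊤ = ⊥ :=
    LinearMap.BilinForm.orthogonal_top_eq_bot (stdForm_nondegenerate p ι)
  have h1 := phaseSum_eq h2 hC
  rw [Finset.sum_eq_single 0 (fun b _ hb => by rw [if_neg]; rw [hbot]; simpa using hb)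
    (fun h => absurd (Finset.mem_univ _) h)] at h1
  rw [if_pos (Submodule.zero_mem _), disp_zero, map_zero, neg_zero, AddChar.map_zero_eq_one,
    mul_one] at h1
  have e1 : (Nat.card (⊤ : Submodule (ZMod p) (Phase p ι)) : ℂ) =
      (p : ℂ) ^ Fintype.card ι * (p : ℂ) ^ Fintype.card ι := by
    rw [Nat.card_congr (Submodule.topEquiv (R := ZMod p) (M := Phase p ι)).toEquiv]
    simp [Nat.card_eq_fintype_card, ZMod.card]
  rw [e1, mul_smul, smul_right_inj (pow_ne_zero _ p_ne_zero)] at h1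
  rw [h1] at h
  have h3 := h.smul_zpow (-(2 * Fintype.card ι : ℤ))
  convert h3 using 1
  ext w e
  simp only [ketMap, vecOp, Matrix.smul_apply, smul_eq_mul, ← mul_assoc]
  rw [zpow_neg, zpow_mul, zpow_ofNat, sq, ← Complex.ofReal_mul, Real.mul_self_sqrt (by positivity)]
  simp

theorem isStab_bend (h2 : (2 : ZMod p) ≠ 0) {ψ : (ι ⊕ κ → ZMod p) → ℂ}
    (h : IsStab p (ketMap ψ)) :
    IsStab p (Matrix.of fun (y : κ → ZMod p) (x : ι → ZMod p) => ψ (Sum.elim x y)) := by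
  have h1 := (IsStab.tensor _ _ (isStab_one (p := p) (ι := ι)) h).relabelled
    (Equiv.sumEmpty ι Empty) (Equiv.sumAssoc ι ι κ).symm
  have h3 := (IsStab.tensor _ _ (isStab_bell (p := p) (ι := ι) h2).adjoint
    (isStab_one (p := p) (ι := κ))).relabelled (Equiv.refl _) (Equiv.emptySum Empty κ)
  have h4 := IsStab.comp _ _ h1 h3
  convert h4 using 1
  ext y x
  rw [Matrix.mul_apply, sum_sumArrow]
  simp only [sum_sumArrow, Matrix.of_apply, Matrix.submatrix_apply, tensorMap,
    Matrix.conjTranspose_apply, ketMap, vecOp, Matrix.one_apply, Equiv.refl_apply, Sum.elim_inl,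
    Sum.elim_inr, Equiv.sumAssoc_symm_apply_inl, Equiv.sumEmpty_apply_inl, Equiv.emptySum_apply_inr,
    apply_ite star, star_one, star_zero, ite_mul, one_mul, zero_mul]
  rw [Finset.sum_eq_single x, Finset.sum_eq_single x, Finset.sum_eq_single y]
  · simp
    congr 1
    ext i; cases i <;> rfl
  · intro b _ hb; simp [hb.symm]
  · simp
  · intro b _ hb; simp [hb.symm]
  · simp
  · intro b _ hb; simp [hb]
  · simp

/-- The superoperator with Choi operator `T`. -/
def choiMap (T : Op p (ι ⊕ κ)) : Op p ι →ₗ[ℂ] Op p κ where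
  toFun ρ := Matrix.of fun y y' => ∑ x : ι → ZMod p, ∑ x' : ι → ZMod p,
    ρ x x' * T (Sum.elim x y) (Sum.elim x' y')
  map_add' ρ ρ' := by
    ext y y'
    simp [add_mul, Finset.sum_add_distrib]
  map_smul' c ρ := by
    ext y y'
    simp [mul_assoc, Finset.mul_sum]

theorem isMixedStab_choiMap (h2 : (2 : ZMod p) ≠ 0) {C : Set (Phase p (ι ⊕ κ))}
    {a : Phase p (ι ⊕ κ)} {K : Submodule (ZMod p) (Phase p (ι ⊕ κ))} (hC : IsCoset C a K)
    (hK : (stdForm p (ι ⊕ κ)).orthogonal K ≤ K) : IsMixedStab (choiMap (phaseSum C)) := by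
  obtain ⟨m, hm⟩ := phaseSum_mul_self h2 hC hK
  set T := phaseSum C with hT
  have hTT : T.conjTranspose = T := phaseSum_conjTranspose C
  let d : (ι ⊕ κ) ⊕ (ι ⊕ κ) ≃ (ι ⊕ (ι ⊕ κ)) ⊕ κ :=
    (Equiv.sumAssoc ι κ (ι ⊕ κ)).trans (((Equiv.refl ι).sumCongr (Equiv.sumComm κ (ι ⊕ κ))).trans
      (Equiv.sumAssoc ι (ι ⊕ κ) κ).symm)
  have h1 := (isStab_vecOp h2 hC hK).relabelled (Equiv.refl Empty) d
  have h3 : IsStab p (ketMap fun w : (ι ⊕ (ι ⊕ κ)) ⊕ κ → ZMod p =>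
      vecOp T fun i => w (d i)) := h1
  have h4 := isStab_bend h2 h3
  have h5 : IsMixedStab ((p : ℂ) ^ m • choiMap T) := by
    refine ⟨_, inferInstance, inferInstance, _, h4, fun ρ => ?_⟩
    ext y y'
    have e1 (x : ι → ZMod p) (s : ι ⊕ κ → ZMod p) (y : κ → ZMod p) :
        vecOp T (fun i => Sum.elim (Sum.elim x s) y (d i)) = T (Sum.elim x y) s := by
      simp only [vecOp]
      congr 1
      · ext i; cases i <;> rfl
    have e2 (w w' : ι ⊕ κ → ZMod p) : (p : ℂ) ^ m * T w w' = ∑ s, T w s * star (T w' s) := by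
      have := congrFun (congrFun hm w) w'
      rw [Matrix.smul_apply, smul_eq_mul] at this
      rw [← this]
      conv_lhs => enter [2]; rw [← hTT]
      rfl
    have e3 : ((p : ℂ) ^ m • choiMap T) ρ y y' = ∑ x : ι → ZMod p, ∑ x' : ι → ZMod p,
        ∑ s, T (Sum.elim x y) s * ρ x x' * star (T (Sum.elim x' y') s) := by
      change (p : ℂ) ^ m * (∑ x : ι → ZMod p, ∑ x' : ι → ZMod p,
        ρ x x' * T (Sum.elim x y) (Sum.elim x' y')) = _
      simp only [Finset.mul_sum]
      refine Finset.sum_congr rfl fun x _ => Finset.sum_congr rfl fun x' _ => ?_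
      rw [mul_left_comm, e2, Finset.mul_sum]
      exact Finset.sum_congr rfl fun s _ => by ring
    rw [e3, Matrix.mul_apply]
    simp only [Matrix.mul_apply, Matrix.conjTranspose_apply, Matrix.of_apply, tensorMap,
      sum_sumArrow (ι := ι) (κ := ι ⊕ κ), e1, Sum.elim_inl, Sum.elim_inr, Matrix.one_apply,
      mul_ite, mul_one, mul_zero, Finset.sum_ite_eq', Finset.mem_univ, if_true]
    simp only [Finset.sum_mul]
    rw [Finset.sum_comm]
    exact Finset.sum_congr rfl fun x' _ => Finset.sum_comm
  have h6 := h5.smul (-m)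
  rwa [smul_smul, ← zpow_add₀ p_ne_zero, neg_add_cancel, zpow_zero, one_smul] at h6

end Dilation

/-- The objects of `StabChan_p = Caus(Split†(CPM(Stab_p)))`: nonzero dagger-idempotents in
`CPM(Stab_p)`, the dagger of a superoperator being its adjoint for the Hilbert-Schmidt inner
product. -/
structure StabChan (p : ℕ) [Fact p.Prime] where
  wires : Type
  [fintype : Fintype wires]
  [decidableEq : DecidableEq wires]
  idem : Op p wires →ₗ[ℂ] Op p wires
  isMixedStab : IsMixedStab idem
  selfAdjoint : ∀ ρ τ : Op p wires,
    ((idem ρ).conjTranspose * τ).trace = (ρ.conjTranspose * idem τ).trace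
  idem_comp_idem : idem ∘ₗ idem = idem
  ne_zero : idem ≠ 0

attribute [instance] StabChan.fintype StabChan.decidableEq

/-- The morphisms of `StabChan_p`: the morphisms of `CPM(Stab_p)` that absorb the idempotents and
are causal, that is, they preserve the trace of the split object. -/
@[ext] structure StabChan.Hom {p : ℕ} [Fact p.Prime] (X Y : StabChan p) where
  map : Op p X.wires →ₗ[ℂ] Op p Y.wires
  isMixedStab : IsMixedStab map
  absorb : Y.idem ∘ₗ map ∘ₗ X.idem = map
  causal : ∀ ρ : Op p X.wires, (map ρ).trace = (X.idem ρ).trace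

theorem StabChan.Hom.idem_comp {p : ℕ} [Fact p.Prime] {X Y : StabChan p} (f : StabChan.Hom X Y) :
    Y.idem ∘ₗ f.map = f.map := by
  conv_lhs => rw [← f.absorb]
  rw [← LinearMap.comp_assoc, Y.idem_comp_idem, f.absorb]

theorem StabChan.Hom.comp_idem {p : ℕ} [Fact p.Prime] {X Y : StabChan p} (f : StabChan.Hom X Y) :
    f.map ∘ₗ X.idem = f.map := by
  conv_lhs => rw [← f.absorb]
  rw [LinearMap.comp_assoc, LinearMap.comp_assoc, X.idem_comp_idem, f.absorb]

instance (p : ℕ) [Fact p.Prime] : Category (StabChan p) where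
  Hom := StabChan.Hom
  id X := ⟨X.idem, X.isMixedStab, by rw [X.idem_comp_idem, X.idem_comp_idem], fun _ => rfl⟩
  comp f g := ⟨g.map ∘ₗ f.map, f.isMixedStab.comp g.isMixedStab, by
      rw [LinearMap.comp_assoc, f.comp_idem, ← LinearMap.comp_assoc, g.idem_comp], fun ρ => by
      rw [LinearMap.comp_apply, g.causal, ← LinearMap.comp_apply, f.idem_comp, f.causal]⟩
  id_comp f := StabChan.Hom.ext f.comp_idem
  comp_id f := StabChan.Hom.ext f.idem_comp
  assoc f g h := StabChan.Hom.ext (LinearMap.comp_assoc _ _ _).symm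

namespace QCSpace

variable {p : ℕ} [Fact p.Prime]

/-- The register of qupits on which a type is represented: one qupit for each quantum degree of
freedom and one for each classical degree of freedom. -/
noncomputable abbrev wires (X : QCSpace p) : Type :=
  Fin X.quantum.qupits ⊕ Fin (Module.finrank (ZMod p) X.classical.carrier)

noncomputable instance (X : QCSpace p) : Fintype X.Pt :=
  haveI : Finite X.Pt := Module.finite_of_finite (ZMod p)
  Fintype.ofFinite _

/-- The operator that represents a point of a type: a phase-point operator on the quantum part and
a computational basis projector on the classical part. -/
noncomputable def pointOp (X : QCSpace p) (x : X.Pt) : Op p X.wires :=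
  tensorMap (phaseOp (X.quantum.coord x.1))
    (Matrix.single (X.classical.coord x.2) (X.classical.coord x.2) 1)

/-- Decoherence of the classical part in the computational basis. -/
noncomputable def dephase (X : QCSpace p) : Op p X.wires →ₗ[ℂ] Op p X.wires where
  toFun ρ := Matrix.of fun k j =>
    if (fun i => k (Sum.inr i)) = fun i => j (Sum.inr i) then ρ k j else 0
  map_add' ρ τ := by
    ext k j
    simp only [Matrix.of_apply, Matrix.add_apply]
    split_ifs <;> simp
  map_smul' c ρ := by
    ext k j
    simp only [Matrix.of_apply, Matrix.smul_apply, RingHom.id_apply]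
    split_ifs <;> simp

open Classical in
/-- The superoperator represented by a relation `R`: on the level of phase-point operators, a point
`x` is sent to the uniform distribution on the points `y` with `(x, y) ∈ R`. -/
noncomputable def relMap (X Y : QCSpace p) (R : Set (X.Pt × Y.Pt)) :
    Op p X.wires →ₗ[ℂ] Op p Y.wires where
  toFun ρ := ∑ x : X.Pt, ∑ y : Y.Pt,
    if (x, y) ∈ R then
      (((p : ℂ) ^ X.quantum.qupits)⁻¹ * (Nat.card {y : Y.Pt // (x, y) ∈ R} : ℂ)⁻¹ *
        (X.pointOp x * ρ).trace) • Y.pointOp y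
    else 0
  map_add' ρ τ := by
    simp only [Matrix.trace_add, mul_add, add_smul, ← Finset.sum_add_distrib]
    refine Finset.sum_congr rfl fun x _ => Finset.sum_congr rfl fun y _ => ?_
    split_ifs <;> simp
  map_smul' c ρ := by
    simp only [Matrix.mul_smul, Matrix.trace_smul, Finset.smul_sum, RingHom.id_apply]
    refine Finset.sum_congr rfl fun x _ => Finset.sum_congr rfl fun y _ => ?_
    split_ifs
    · rw [smul_smul, smul_eq_mul]; congr 1; ring
    · simp

end QCSpace

section PointLemmas

set_option linter.unusedSectionVars false

variable {p : ℕ} [Fact p.Prime] {ι κ : Type} [Fintype ι] [DecidableEq ι] [Fintype κ] [DecidableEq κ]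

theorem tensorMap_trace (A : Op p ι) (B : Op p κ) : (tensorMap A B).trace = A.trace * B.trace := by
  simp only [Matrix.trace, Matrix.diag_apply, sum_sumArrow, tensorMap, Sum.elim_inl, Sum.elim_inr,
    Finset.sum_mul_sum]

theorem add_self_inj (h2 : (2 : ZMod p) ≠ 0) {a b : ι → ZMod p} (h : a + a = b + b) : a = b := by
  rw [← two_smul (ZMod p) a, ← two_smul (ZMod p) b] at h
  exact smul_right_injective _ h2 h

theorem phaseOp_trace_mul (h2 : (2 : ZMod p) ≠ 0) (v w : Phase p ι) :
    (phaseOp v * phaseOp w).trace = if v = w then (p : ℂ) ^ Fintype.card ι else 0 := by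
  have h1 (k : ι → ZMod p) : (phaseOp v * phaseOp w) k k =
      if v.1 = w.1 then rootChar p ((2 * -(w.2 ⬝ᵥ k - v.2 ⬝ᵥ k)) + 2 * ((w.2 - v.2) ⬝ᵥ v.1))
      else 0 := by
    rw [Matrix.mul_apply, Finset.sum_eq_single (v.1 + v.1 - k)]
    · simp only [phaseOp, add_sub_cancel, sub_add_cancel, if_true]
      by_cases h : v.1 = w.1
      · rw [if_pos h, if_pos (by rw [h]), rootChar_mul]
        congr 1
        simp only [dotProduct_sub, dotProduct_add, sub_dotProduct]
        ring
      · rw [if_neg h, if_neg (fun h' => h (add_self_inj h2 h')), mul_zero]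
    · intro j _ hj
      rw [phaseOp, if_neg, zero_mul]
      intro h'
      exact hj (by rw [← h']; abel)
    · simp
  rw [Matrix.trace]
  simp only [Matrix.diag_apply, h1]
  by_cases h : v.1 = w.1
  · simp only [if_pos h, ← rootChar_mul, ← Finset.sum_mul]
    have h3 (k : ι → ZMod p) : 2 * -(w.2 ⬝ᵥ k - v.2 ⬝ᵥ k) = k ⬝ᵥ ((2 : ZMod p) • (v.2 - w.2)) := by
      rw [dotProduct_smul, dotProduct_sub, dotProduct_comm k, dotProduct_comm k, smul_eq_mul]; ring
    simp only [h3, sum_rootChar]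
    by_cases h4 : v.2 = w.2
    · rw [if_pos (by rw [h4]; simp), if_pos (Prod.ext h h4), h4]; simp
    · rw [if_neg, if_neg (fun h' => h4 (congrArg Prod.snd h')), zero_mul]
      rw [smul_eq_zero]
      rintro (h5 | h5)
      · exact h2 h5
      · exact h4 (sub_eq_zero.1 h5)
  · simp only [if_neg h]
    rw [if_neg (fun h' => h (congrArg Prod.fst h'))]; simp

theorem sum_phaseOp_phaseOp (h2 : (2 : ZMod p) ≠ 0) (a b k j : ι → ZMod p) :
    ∑ v : Phase p ι, phaseOp v a b * phaseOp v k j =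
      if a = j ∧ b = k then (p : ℂ) ^ Fintype.card ι else 0 := by
  rw [Fintype.sum_prod_type, Finset.sum_eq_single ((2⁻¹ : ZMod p) • (a + b))]
  · have e1 : (2⁻¹ : ZMod p) • (a + b) + (2⁻¹ : ZMod p) • (a + b) = a + b := half_add h2 _
    simp only [phaseOp, e1, if_true]
    by_cases h : k + j = a + b
    · simp only [if_pos h, rootChar_mul, ← dotProduct_add, sum_rootChar]
      congr 1
      refine propext ⟨fun h' => ?_, ?_⟩
      · have h3 : a = j := add_self_inj h2 (by linear_combination h' - h)
        exact ⟨h3, by rw [h3, add_comm] at h; exact (add_left_cancel (h.trans (by rfl))).symm⟩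
      · rintro ⟨rfl, rfl⟩; abel
    · simp only [if_neg h, mul_zero, Finset.sum_const_zero]
      rw [if_neg]
      rintro ⟨rfl, rfl⟩
      exact h (add_comm _ _)
  · intro x _ hx
    refine Finset.sum_eq_zero fun z _ => ?_
    rw [phaseOp, if_neg, zero_mul]
    intro h
    apply hx
    simp only at h
    rw [h, smul_add, half_add h2]
  · simp

theorem sum_phaseOp_snd (h2 : (2 : ZMod p) ≠ 0) (x : ι → ZMod p) :
    ∑ z : ι → ZMod p, phaseOp (x, z) = (p : ℂ) ^ Fintype.card ι • Matrix.single x x (1 : ℂ) := by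
  ext k j
  rw [Matrix.sum_apply]
  simp only [phaseOp, Matrix.smul_apply, Matrix.single_apply, smul_eq_mul]
  by_cases h : k + j = x + x
  · simp only [if_pos h, sum_rootChar, sub_eq_zero, mul_ite, mul_one, mul_zero]
    congr 1
    refine propext ⟨fun h' => ?_, ?_⟩
    · rw [h'] at h ⊢
      have := add_self_inj h2 h
      exact ⟨this.symm, this.symm⟩
    · rintro ⟨rfl, rfl⟩; rfl
  · simp only [if_neg h, Finset.sum_const_zero]
    rw [if_neg, mul_zero]
    rintro ⟨rfl, rfl⟩
    exact h rfl

theorem phaseOp_sum (w : Phase p (ι ⊕ κ)) :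
    phaseOp w = tensorMap (phaseOp (fun i => w.1 (.inl i), fun i => w.2 (.inl i)))
      (phaseOp (fun i => w.1 (.inr i), fun i => w.2 (.inr i))) := by
  ext k j
  simp only [tensorMap, phaseOp]
  have e1 : (k + j = w.1 + w.1) ↔
      ((fun i => k (.inl i)) + (fun i => j (.inl i)) =
        (fun i => w.1 (.inl i)) + (fun i => w.1 (.inl i))) ∧
      ((fun i => k (.inr i)) + (fun i => j (.inr i)) =
        (fun i => w.1 (.inr i)) + (fun i => w.1 (.inr i))) := by
    constructor
    · intro h; exact ⟨funext fun i => congrFun h _, funext fun i => congrFun h _⟩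
    · rintro ⟨h1, h2⟩
      ext i
      rcases i with i | i
      · exact congrFun h1 i
      · exact congrFun h2 i
  simp only [e1, ite_mul, mul_ite, zero_mul, mul_zero, ite_and]
  split_ifs
  · rw [rootChar_mul]
    congr 1
    simp only [dotProduct, Fintype.sum_sum_type, Pi.sub_apply]
  all_goals rfl

end PointLemmas

namespace QCSpace

variable {p : ℕ} [Fact p.Prime]

theorem sum_pt {M : Type} [AddCommMonoid M] (X : QCSpace p)
    (F : Phase p (Fin X.quantum.qupits) →
      (Fin (Module.finrank (ZMod p) X.classical.carrier) → ZMod p) → M) :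
    ∑ x : X.Pt, F (X.quantum.coord x.1) (X.classical.coord x.2) = ∑ v, ∑ w, F v w := by
  rw [← Fintype.sum_prod_type']
  exact Fintype.sum_equiv (X.quantum.coord.toEquiv.prodCongr X.classical.coord.toEquiv) _ _
    fun _ => rfl

open Classical in
theorem trace_pointOp_mul (h2 : (2 : ZMod p) ≠ 0) (X : QCSpace p) (x y : X.Pt) :
    (X.pointOp x * X.pointOp y).trace = if x = y then (p : ℂ) ^ X.quantum.qupits else 0 := by
  rw [pointOp, pointOp, tensorMap_mul, tensorMap_trace, phaseOp_trace_mul h2]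
  have e : x = y ↔ X.quantum.coord x.1 = X.quantum.coord y.1 ∧
      X.classical.coord x.2 = X.classical.coord y.2 := by
    rw [Prod.ext_iff, X.quantum.coord.injective.eq_iff, X.classical.coord.injective.eq_iff]
  by_cases h : X.classical.coord x.2 = X.classical.coord y.2
  · simp [e, h]
  · simp [e, h]

theorem sum_pointOp (h2 : (2 : ZMod p) ≠ 0) (X : QCSpace p) (ρ : Op p X.wires) :
    ∑ x : X.Pt, (((p : ℂ) ^ X.quantum.qupits)⁻¹ * (X.pointOp x * ρ).trace) • X.pointOp x =
      X.dephase ρ := by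
  ext k j
  have hp : (p : ℂ) ^ X.quantum.qupits ≠ 0 := pow_ne_zero _ p_ne_zero
  rw [Matrix.sum_apply]
  have h1 (x : X.Pt) : ((((p : ℂ) ^ X.quantum.qupits)⁻¹ * (X.pointOp x * ρ).trace) •
      X.pointOp x) k j = ∑ a, ∑ b, ((p : ℂ) ^ X.quantum.qupits)⁻¹ * ρ b a *
        (X.pointOp x a b * X.pointOp x k j) := by
    simp only [Matrix.smul_apply, Matrix.trace, Matrix.diag_apply, Matrix.mul_apply, smul_eq_mul,
      Finset.mul_sum, Finset.sum_mul]
    exact Finset.sum_congr rfl fun _ _ => Finset.sum_congr rfl fun _ _ => by ring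
  have h3 (a b : X.wires → ZMod p) : ∑ x : X.Pt, X.pointOp x a b * X.pointOp x k j =
      if a = j ∧ b = k ∧ (fun i => k (Sum.inr i)) = (fun i => j (Sum.inr i)) then
        (p : ℂ) ^ X.quantum.qupits else 0 := by
    simp only [pointOp]
    rw [sum_pt X fun v w => tensorMap (phaseOp v) (Matrix.single w w 1) a b *
      tensorMap (phaseOp v) (Matrix.single w w 1) k j]
    simp only [tensorMap, Matrix.single_apply]
    have h4 (v : Phase p (Fin X.quantum.qupits))
        (w : Fin (Module.finrank (ZMod p) X.classical.carrier) → ZMod p) :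
        (phaseOp v (fun i => a (Sum.inl i)) fun i => b (Sum.inl i)) *
            (if (w = fun i => a (Sum.inr i)) ∧ w = fun i => b (Sum.inr i) then (1 : ℂ) else 0) *
          ((phaseOp v (fun i => k (Sum.inl i)) fun i => j (Sum.inl i)) *
            if (w = fun i => k (Sum.inr i)) ∧ w = fun i => j (Sum.inr i) then 1 else 0) =
        ((phaseOp v (fun i => a (Sum.inl i)) fun i => b (Sum.inl i)) *
          (phaseOp v (fun i => k (Sum.inl i)) fun i => j (Sum.inl i))) *
        (if w = (fun i => a (Sum.inr i)) then
          (if (fun i => a (Sum.inr i)) = (fun i => b (Sum.inr i)) ∧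
            (fun i => a (Sum.inr i)) = (fun i => k (Sum.inr i)) ∧
            (fun i => a (Sum.inr i)) = (fun i => j (Sum.inr i)) then 1 else 0) else 0) := by
      by_cases hw : w = fun i => a (Sum.inr i)
      · subst hw
        simp only [true_and, if_true, ite_and]
        split_ifs <;> ring
      · simp [hw]
    simp only [h4, ← Finset.mul_sum, Finset.sum_ite_eq', Finset.mem_univ, if_true]
    rw [← Finset.sum_mul, sum_phaseOp_phaseOp h2, Fintype.card_fin]
    have e1 (u v : X.wires → ZMod p) : u = v ↔ ((fun i => u (Sum.inl i)) = fun i => v (Sum.inl i)) ∧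
        (fun i => u (Sum.inr i)) = fun i => v (Sum.inr i) := by
      constructor
      · rintro rfl; exact ⟨rfl, rfl⟩
      · rintro ⟨h5, h6⟩
        ext i
        rcases i with i | i
        · exact congrFun h5 i
        · exact congrFun h6 i
    rw [mul_ite, mul_one, mul_zero, ← ite_and]
    refine if_congr ?_ rfl rfl
    rw [e1 a j, e1 b k]
    constructor
    · rintro ⟨⟨h7, h8, h9⟩, h5, h6⟩
      exact ⟨⟨h5, h9⟩, ⟨h6, h7.symm.trans h8⟩, h8.symm.trans h9⟩
    · rintro ⟨⟨h5, h6⟩, ⟨h7, h8⟩, h9⟩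
      exact ⟨⟨(h6.trans h9.symm).trans h8.symm, h6.trans h9.symm, h6⟩, h5, h7⟩
  simp only [h1]
  rw [Finset.sum_comm]
  simp only [Finset.sum_comm (s := (Finset.univ : Finset X.Pt)), ← Finset.mul_sum, h3]
  simp only [dephase, LinearMap.coe_mk, AddHom.coe_mk, Matrix.of_apply, ite_and, mul_ite, mul_zero]
  rw [Finset.sum_eq_single j (fun b _ hb => by simp [hb]) (by simp),
    Finset.sum_eq_single k (fun b _ hb => by simp [hb]) (by simp)]
  simp only [if_true]
  split_ifs
  · field_simp
  · rfl

end QCSpace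

namespace QCSpace

set_option linter.unusedSectionVars false

variable {p : ℕ} [Fact p.Prime]

theorem _root_.IsCoset.recenter {V : Type} [AddCommGroup V] [Module (ZMod p) V] {C : Set V} {a b : V}
    {K : Submodule (ZMod p) V} (hC : IsCoset C a K) (hb : b ∈ C) : IsCoset C b K := fun x => by
  rw [hC]
  have h1 : b - a ∈ K := (hC _).1 hb
  constructor
  · intro h2; have := K.sub_mem h2 h1; simpa using this
  · intro h2; have := K.add_mem h2 h1; simpa using this

theorem exists_fiber_card {X Y : QCSpace p} {R : Set (X.Pt × Y.Pt)} {a : X.Pt × Y.Pt}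
    {K : Submodule (ZMod p) (X.Pt × Y.Pt)} (hC : IsCoset R a K) (hT : relTotal R) :
    ∃ m : ℕ, ∀ x, Nat.card {y : Y.Pt // (x, y) ∈ R} = p ^ m := by
  refine ⟨Module.finrank (ZMod p) (K.comap (LinearMap.inr (ZMod p) X.Pt Y.Pt)), fun x => ?_⟩
  obtain ⟨y, hy⟩ := hT x
  have h := Module.natCard_eq_pow_finrank (K := ZMod p)
    (V := K.comap (LinearMap.inr (ZMod p) X.Pt Y.Pt))
  rw [Nat.card_zmod] at h
  rw [← h]
  refine Nat.card_congr ((Equiv.subRight y).subtypeEquiv fun y' => ?_)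
  rw [hC.recenter hy]
  simp

theorem exists_middle_card {X Y Z : QCSpace p} {R : Set (X.Pt × Y.Pt)} {a : X.Pt × Y.Pt}
    {K : Submodule (ZMod p) (X.Pt × Y.Pt)} (hC : IsCoset R a K) {S : Set (Y.Pt × Z.Pt)}
    {b : Y.Pt × Z.Pt} {L : Submodule (ZMod p) (Y.Pt × Z.Pt)} (hD : IsCoset S b L) :
    ∃ M : ℕ, ∀ x z, (x, z) ∈ relComp R S →
      Nat.card {y : Y.Pt // (x, y) ∈ R ∧ (y, z) ∈ S} = M := by
  refine ⟨Nat.card {d : Y.Pt // ((0 : X.Pt), d) ∈ K ∧ (d, (0 : Z.Pt)) ∈ L}, fun x z h => ?_⟩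
  obtain ⟨y, hy, hy'⟩ := h
  refine Nat.card_congr ((Equiv.subRight y).subtypeEquiv fun y' => ?_)
  rw [hC.recenter hy, hD.recenter hy']
  simp

theorem sum_ite_card (Y : QCSpace p) (P : Y.Pt → Prop) [DecidablePred P] :
    (∑ y : Y.Pt, if P y then (1 : ℂ) else 0) = (Nat.card {y : Y.Pt // P y} : ℂ) := by
  rw [Finset.sum_boole, Nat.card_eq_fintype_card, Fintype.card_subtype]

theorem exists_coset {X Y : QCSpace p} {R : Set (X.Pt × Y.Pt)} (hR : X.Good Y R)
    (hT : relTotal R) : ∃ (a : X.Pt × Y.Pt) (S : Submodule (ZMod p) (X.Pt × Y.Pt)), IsCoset R a S ∧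
    ∀ (v : X.quantum.carrier) (v' : Y.quantum.carrier)
      (α : Module.Dual (ZMod p) X.classical.carrier)
      (β : Module.Dual (ZMod p) Y.classical.carrier),
      (∀ d ∈ S, -X.quantum.form v d.1.1 + Y.quantum.form v' d.2.1 + α d.1.2 + β d.2.2 = 0) →
        ((v, 0), (v', 0)) ∈ S := by
  refine hR.resolve_left fun h => ?_
  obtain ⟨y, hy⟩ := hT 0
  rw [h] at hy
  exact hy

open Classical in
theorem relMap_apply {X Y : QCSpace p} {R : Set (X.Pt × Y.Pt)} {r : ℕ}
    (hr : ∀ x, Nat.card {y : Y.Pt // (x, y) ∈ R} = r) (ρ : Op p X.wires) :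
    relMap X Y R ρ = ∑ x : X.Pt, (((p : ℂ) ^ X.quantum.qupits)⁻¹ * (X.pointOp x * ρ).trace) •
      ∑ y : Y.Pt, (if (x, y) ∈ R then (r : ℂ)⁻¹ else 0) • Y.pointOp y := by
  simp only [relMap, LinearMap.coe_mk, AddHom.coe_mk, hr, Finset.smul_sum]
  refine Finset.sum_congr rfl fun x _ => Finset.sum_congr rfl fun y _ => ?_
  split_ifs
  · rw [smul_smul]; congr 1; ring
  · simp

open Classical in
theorem relMap_pointOp (h2 : (2 : ZMod p) ≠ 0) {X Y : QCSpace p} {R : Set (X.Pt × Y.Pt)} {r : ℕ}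
    (hr : ∀ x, Nat.card {y : Y.Pt // (x, y) ∈ R} = r) (x : X.Pt) :
    relMap X Y R (X.pointOp x) =
      ∑ y : Y.Pt, (if (x, y) ∈ R then (r : ℂ)⁻¹ else 0) • Y.pointOp y := by
  rw [relMap_apply hr, Finset.sum_eq_single x]
  · rw [trace_pointOp_mul h2, if_pos rfl, inv_mul_cancel₀ (pow_ne_zero _ p_ne_zero), one_smul]
  · intro b _ hb
    rw [trace_pointOp_mul h2, if_neg hb, mul_zero, zero_smul]
  · simp

theorem relMap_id (h2 : (2 : ZMod p) ≠ 0) (X : QCSpace p) : relMap X X (relId X.Pt) = X.dephase := by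
  classical
  have hr (x : X.Pt) : Nat.card {y : X.Pt // (x, y) ∈ relId X.Pt} = 1 := by
    rw [Nat.card_eq_one_iff_unique]
    exact ⟨⟨fun a b => Subtype.ext (a.2.symm.trans b.2)⟩, ⟨⟨x, rfl⟩⟩⟩
  ext1 ρ
  rw [relMap_apply hr, ← sum_pointOp h2]
  refine Finset.sum_congr rfl fun x _ => ?_
  congr 1
  rw [Finset.sum_eq_single x]
  · simp [relId]
  · intro y _ hy
    have h' : (x, y) ∉ relId X.Pt := fun h => hy (Eq.symm h)
    rw [if_neg h', zero_smul]
  · simp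

theorem relMap_comp (h2 : (2 : ZMod p) ≠ 0) {X Y Z : QCSpace p} {R : Set (X.Pt × Y.Pt)}
    {S : Set (Y.Pt × Z.Pt)} (hR : X.Good Y R) (hR' : relTotal R) (hS : Y.Good Z S)
    (hS' : relTotal S) : relMap X Z (relComp R S) = relMap Y Z S ∘ₗ relMap X Y R := by
  classical
  obtain ⟨a, K, hC, -⟩ := exists_coset hR hR'
  obtain ⟨b, L, hD, -⟩ := exists_coset hS hS'
  obtain ⟨c, N, hE, -⟩ := exists_coset (good_comp hR hS) (relTotal_comp hR' hS')
  obtain ⟨r, hr⟩ := exists_fiber_card hC hR'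
  obtain ⟨s, hs⟩ := exists_fiber_card hD hS'
  obtain ⟨t, ht⟩ := exists_fiber_card hE (relTotal_comp hR' hS')
  obtain ⟨M, hM⟩ := exists_middle_card hC hD
  have hN (x : X.Pt) (z : Z.Pt) : (∑ y : Y.Pt, if (x, y) ∈ R ∧ (y, z) ∈ S then (1 : ℂ) else 0) =
      if (x, z) ∈ relComp R S then (M : ℂ) else 0 := by
    split_ifs with h
    · rw [sum_ite_card, hM x z h]
    · refine Finset.sum_eq_zero fun y _ => if_neg fun h' => h ⟨y, h'⟩
  have hcount (x : X.Pt) : ((p ^ t : ℕ) : ℂ) * M = ((p ^ r : ℕ) : ℂ) * ((p ^ s : ℕ) : ℂ) := by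
    have e1 : (∑ z : Z.Pt, ∑ y : Y.Pt, if (x, y) ∈ R ∧ (y, z) ∈ S then (1 : ℂ) else 0) =
        ((p ^ t : ℕ) : ℂ) * M := by
      rw [← ht x, ← sum_ite_card, Finset.sum_mul]
      exact Finset.sum_congr rfl fun z _ => by rw [hN]; split_ifs <;> simp
    rw [← e1, Finset.sum_comm, ← hr x, ← sum_ite_card, Finset.sum_mul]
    refine Finset.sum_congr rfl fun y _ => ?_
    rw [← hs y, ← sum_ite_card, Finset.mul_sum]
    exact Finset.sum_congr rfl fun z _ => by
      by_cases h1 : (x, y) ∈ R <;> by_cases h3 : (y, z) ∈ S <;> simp [h1, h3]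
  ext1 ρ
  rw [LinearMap.comp_apply, relMap_apply hr, relMap_apply ht, map_sum]
  refine Finset.sum_congr rfl fun x _ => ?_
  rw [map_smul, map_sum]
  congr 1
  simp only [map_smul, relMap_pointOp h2 hs, Finset.smul_sum, smul_smul]
  rw [Finset.sum_comm]
  refine Finset.sum_congr rfl fun z _ => ?_
  rw [← Finset.sum_smul]
  congr 1
  have e2 (y : Y.Pt) : (if (x, y) ∈ R then ((p ^ r : ℕ) : ℂ)⁻¹ else 0) *
      (if (y, z) ∈ S then ((p ^ s : ℕ) : ℂ)⁻¹ else 0) =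
      (if (x, y) ∈ R ∧ (y, z) ∈ S then (1 : ℂ) else 0) *
        (((p ^ r : ℕ) : ℂ)⁻¹ * ((p ^ s : ℕ) : ℂ)⁻¹) := by
    by_cases h1 : (x, y) ∈ R <;> by_cases h3 : (y, z) ∈ S <;> simp [h1, h3]
  have hne (k : ℕ) : ((p ^ k : ℕ) : ℂ) ≠ 0 := by
    rw [Nat.cast_pow]; exact pow_ne_zero _ p_ne_zero
  rw [Finset.sum_congr rfl fun y _ => e2 y, ← Finset.sum_mul, hN]
  split_ifs
  · rw [← mul_inv, ← hcount x, mul_inv]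
    have hM0 : (M : ℂ) ≠ 0 := fun h0 => by
      have := hcount x
      rw [h0, mul_zero] at this
      exact mul_ne_zero (hne r) (hne s) this.symm
    field_simp
  · simp

theorem pointOp_trace (h2 : (2 : ZMod p) ≠ 0) (X : QCSpace p) (x : X.Pt) :
    (X.pointOp x).trace = 1 := by
  rw [pointOp, tensorMap_trace, phaseOp_trace h2]
  simp

theorem dephase_trace (X : QCSpace p) (ρ : Op p X.wires) : (X.dephase ρ).trace = ρ.trace := by
  simp [Matrix.trace, dephase]

theorem relMap_trace (h2 : (2 : ZMod p) ≠ 0) {X Y : QCSpace p} {R : Set (X.Pt × Y.Pt)}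
    (hR : X.Good Y R) (hT : relTotal R) (ρ : Op p X.wires) :
    (relMap X Y R ρ).trace = (X.dephase ρ).trace := by
  classical
  obtain ⟨a, K, hC, -⟩ := exists_coset hR hT
  obtain ⟨r, hr⟩ := exists_fiber_card hC hT
  rw [relMap_apply hr, ← sum_pointOp h2]
  simp only [Matrix.trace_sum, Matrix.trace_smul, pointOp_trace h2, smul_eq_mul, mul_one]
  refine Finset.sum_congr rfl fun x _ => ?_
  have : (∑ y : Y.Pt, if (x, y) ∈ R then ((p ^ r : ℕ) : ℂ)⁻¹ else 0) = 1 := by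
    have e : ∀ y : Y.Pt, (if (x, y) ∈ R then ((p ^ r : ℕ) : ℂ)⁻¹ else 0) =
        (if (x, y) ∈ R then 1 else 0) * ((p ^ r : ℕ) : ℂ)⁻¹ := fun y => by split_ifs <;> simp
    rw [Finset.sum_congr rfl fun y _ => e y, ← Finset.sum_mul, sum_ite_card, hr,
      mul_inv_cancel₀]
    rw [Nat.cast_pow]; exact pow_ne_zero _ p_ne_zero
  rw [this, mul_one]

theorem dephase_idem (X : QCSpace p) : X.dephase ∘ₗ X.dephase = X.dephase := by
  ext1 ρ
  ext k j
  simp only [dephase, LinearMap.comp_apply, LinearMap.coe_mk, AddHom.coe_mk, Matrix.of_apply]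
  split_ifs <;> rfl

theorem dephase_selfAdjoint (X : QCSpace p) (ρ τ : Op p X.wires) :
    ((X.dephase ρ).conjTranspose * τ).trace = (ρ.conjTranspose * X.dephase τ).trace := by
  simp only [Matrix.trace, Matrix.diag_apply, Matrix.mul_apply, Matrix.conjTranspose_apply,
    dephase, LinearMap.coe_mk, AddHom.coe_mk, Matrix.of_apply]
  refine Finset.sum_congr rfl fun x _ => Finset.sum_congr rfl fun y _ => ?_
  split_ifs <;> simp

theorem dephase_ne_zero (X : QCSpace p) : X.dephase ≠ 0 := fun h => by
  have h1 := congrFun (congrFun (LinearMap.congr_fun h (1 : Op p X.wires)) 0) 0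
  simp [dephase] at h1

/-! ### Lifting to the phase space of the register -/

/-- The point of a type that lies below a point of the phase space of its register: the `Z`
component of the classical wires is discarded. -/
noncomputable def pt (X : QCSpace p) : Phase p X.wires →ₗ[ZMod p] X.Pt :=
  (X.quantum.coord.symm.toLinearMap ∘ₗ
    ((LinearMap.funLeft (ZMod p) (ZMod p) Sum.inl).prodMap
      (LinearMap.funLeft (ZMod p) (ZMod p) Sum.inl))).prod
  (X.classical.coord.symm.toLinearMap ∘ₗ
    LinearMap.funLeft (ZMod p) (ZMod p) Sum.inr ∘ₗ LinearMap.fst _ _ _)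

/-- A lift of a point to the phase space of the register. -/
noncomputable def lift (X : QCSpace p) (x : X.Pt)
    (b : Fin (Module.finrank (ZMod p) X.classical.carrier) → ZMod p) : Phase p X.wires :=
  (Sum.elim (X.quantum.coord x.1).1 (X.classical.coord x.2), Sum.elim (X.quantum.coord x.1).2 b)

theorem pt_lift (X : QCSpace p) (x : X.Pt) (b) : X.pt (X.lift x b) = x := by
  refine Prod.ext ?_ ?_
  · exact X.quantum.coord.symm_apply_apply x.1
  · exact X.classical.coord.symm_apply_apply x.2

theorem lift_pt (X : QCSpace p) (u : Phase p X.wires) :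
    X.lift (X.pt u) (fun i => u.2 (.inr i)) = u := by
  have h1 : X.quantum.coord (X.pt u).1 = (fun i => u.1 (.inl i), fun i => u.2 (.inl i)) :=
    X.quantum.coord.apply_symm_apply _
  have h2 : X.classical.coord (X.pt u).2 = fun i => u.1 (.inr i) :=
    X.classical.coord.apply_symm_apply _
  rw [lift, h1, h2]
  refine Prod.ext ?_ ?_ <;> ext i <;> cases i <;> rfl

theorem sum_lift {M : Type} [AddCommMonoid M] (X : QCSpace p) (F : Phase p X.wires → M) :
    ∑ u, F u = ∑ x : X.Pt, ∑ b, F (X.lift x b) := by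
  rw [← Fintype.sum_prod_type']
  exact Fintype.sum_equiv ⟨fun u => (X.pt u, fun i => u.2 (.inr i)), fun x => X.lift x.1 x.2,
    X.lift_pt, fun x => Prod.ext (X.pt_lift _ _) rfl⟩ _ _ fun u => by
      simp only [Equiv.coe_fn_mk, lift_pt]

theorem sum_phaseOp_lift (h2 : (2 : ZMod p) ≠ 0) (X : QCSpace p) (x : X.Pt) :
    ∑ b, phaseOp (X.lift x b) =
      (p : ℂ) ^ Module.finrank (ZMod p) X.classical.carrier • X.pointOp x := by
  have h1 := sum_phaseOp_snd h2 (X.classical.coord x.2)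
  rw [Fintype.card_fin] at h1
  have h3 (b) : phaseOp (X.lift x b) =
      tensorMap (phaseOp (X.quantum.coord x.1)) (phaseOp (X.classical.coord x.2, b)) := phaseOp_sum _
  simp only [h3]
  ext k j
  have h4 := congrFun (congrFun h1 fun i => k (.inr i)) fun i => j (.inr i)
  rw [Matrix.sum_apply] at h4
  rw [Matrix.sum_apply, Matrix.smul_apply, pointOp]
  simp only [tensorMap, ← Finset.mul_sum, h4, Matrix.smul_apply, smul_eq_mul]
  ring

/-- Reversal of the momenta. -/
def conj {p : ℕ} {ι : Type} : Phase p ι ≃ₗ[ZMod p] Phase p ι :=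
  (LinearEquiv.refl _ _).prodCongr (LinearEquiv.neg _)

/-- The phase space of two registers. -/
def split {p : ℕ} {ι κ : Type} : Phase p (ι ⊕ κ) ≃ Phase p ι × Phase p κ where
  toFun w := ((fun i => w.1 (.inl i), fun i => w.2 (.inl i)),
    (fun i => w.1 (.inr i), fun i => w.2 (.inr i)))
  invFun w := (Sum.elim w.1.1 w.2.1, Sum.elim w.1.2 w.2.2)
  left_inv w := by refine Prod.ext ?_ ?_ <;> ext i <;> cases i <;> rfl
  right_inv _ := rfl

theorem phaseOp_conj {ι : Type} [Fintype ι] [DecidableEq ι] (u : Phase p ι) (k j : ι → ZMod p) :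
    phaseOp (conj u) k j = phaseOp u j k := by
  change (if k + j = u.1 + u.1 then rootChar p ((-u.2) ⬝ᵥ (k - j)) else 0) =
    (if j + k = u.1 + u.1 then rootChar p (u.2 ⬝ᵥ (j - k)) else 0)
  rw [add_comm j k, neg_dotProduct, ← dotProduct_neg, neg_sub]

/-- The map onto the points of a pair of types, with momenta reversed on the source. -/
noncomputable def ptPair (X Y : QCSpace p) :
    Phase p (X.wires ⊕ Y.wires) →ₗ[ZMod p] X.Pt × Y.Pt :=
  (X.pt ∘ₗ conj.toLinearMap ∘ₗ ((LinearMap.funLeft (ZMod p) (ZMod p) Sum.inl).prodMap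
      (LinearMap.funLeft (ZMod p) (ZMod p) Sum.inl))).prod
  (Y.pt ∘ₗ ((LinearMap.funLeft (ZMod p) (ZMod p) Sum.inr).prodMap
      (LinearMap.funLeft (ZMod p) (ZMod p) Sum.inr)))

theorem ptPair_apply (X Y : QCSpace p) (w : Phase p (X.wires ⊕ Y.wires)) :
    ptPair X Y w = (X.pt (conj (split w).1), Y.pt (split w).2) := rfl

/-- A lift of a pair of points. -/
noncomputable def liftPair (X Y : QCSpace p) (d : X.Pt × Y.Pt)
    (b : Fin (Module.finrank (ZMod p) X.classical.carrier) → ZMod p)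
    (b' : Fin (Module.finrank (ZMod p) Y.classical.carrier) → ZMod p) :
    Phase p (X.wires ⊕ Y.wires) :=
  split.symm (conj (X.lift d.1 b), Y.lift d.2 b')

theorem conj_conj {ι : Type} (u : Phase p ι) : conj (conj u) = u :=
  Prod.ext rfl (neg_neg u.2)

theorem ptPair_liftPair (X Y : QCSpace p) (d b b') : ptPair X Y (liftPair X Y d b b') = d := by
  rw [ptPair_apply, liftPair, Equiv.apply_symm_apply]
  simp only [conj_conj, pt_lift]

theorem stdForm_conj {ι : Type} [Fintype ι] (u v : Phase p ι) :
    stdForm p ι (conj u) v = -stdForm p ι u (conj v) := by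
  rw [stdForm_apply, stdForm_apply]
  change u.1 ⬝ᵥ v.2 - (-u.2) ⬝ᵥ v.1 = -(u.1 ⬝ᵥ (-v.2) - u.2 ⬝ᵥ v.1)
  rw [neg_dotProduct, dotProduct_neg]; ring

theorem stdForm_lift (X : QCSpace p) (x : X.Pt) (b) (w : Phase p X.wires) :
    stdForm p X.wires (X.lift x b) w = X.quantum.form x.1 (X.pt w).1 +
      (X.classical.coord x.2 ⬝ᵥ (fun i => w.2 (.inr i)) - b ⬝ᵥ (fun i => w.1 (.inr i))) := by
  rw [stdForm_sum, X.quantum.form_eq]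
  congr 1
  have h1 : X.quantum.coord (X.pt w).1 = (fun i => w.1 (.inl i), fun i => w.2 (.inl i)) :=
    X.quantum.coord.apply_symm_apply _
  rw [h1]
  rfl

theorem coisotropic_comap {X Y : QCSpace p} {S : Submodule (ZMod p) (X.Pt × Y.Pt)}
    (h : ∀ (v : X.quantum.carrier) (v' : Y.quantum.carrier)
      (α : Module.Dual (ZMod p) X.classical.carrier)
      (β : Module.Dual (ZMod p) Y.classical.carrier),
      (∀ d ∈ S, -X.quantum.form v d.1.1 + Y.quantum.form v' d.2.1 + α d.1.2 + β d.2.2 = 0) →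
        ((v, 0), (v', 0)) ∈ S) :
    (stdForm p (X.wires ⊕ Y.wires)).orthogonal (S.comap (ptPair X Y)) ≤ S.comap (ptPair X Y) := by
  intro w hw
  have hform (d : X.Pt × Y.Pt) (hd : d ∈ S) (b b') : -(X.quantum.form d.1.1 (X.pt (conj (split w).1)).1 +
      (X.classical.coord d.1.2 ⬝ᵥ (fun i => (conj (split w).1).2 (.inr i)) -
        b ⬝ᵥ (fun i => (split w).1.1 (.inr i)))) +
      (Y.quantum.form d.2.1 (Y.pt (split w).2).1 +
      (Y.classical.coord d.2.2 ⬝ᵥ (fun i => (split w).2.2 (.inr i)) -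
        b' ⬝ᵥ (fun i => (split w).2.1 (.inr i)))) = 0 := by
    have h1 : stdForm p (X.wires ⊕ Y.wires) (liftPair X Y d b b') w = 0 :=
      hw _ (by rw [Submodule.mem_comap, ptPair_liftPair]; exact hd)
    rw [stdForm_sum] at h1
    change stdForm p X.wires (conj (X.lift d.1 b)) (split w).1 +
      stdForm p Y.wires (Y.lift d.2 b') (split w).2 = 0 at h1
    rw [stdForm_conj, stdForm_lift, stdForm_lift] at h1
    exact h1
  have hX : (fun i => (split w).1.1 (.inr i)) = 0 := by
    ext i
    have := hform 0 S.zero_mem (Pi.single i 1) 0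
    simpa using this
  have hY : (fun i => (split w).2.1 (.inr i)) = 0 := by
    ext i
    have := hform 0 S.zero_mem 0 (Pi.single i 1)
    simpa using this
  have hX' : (X.pt (conj (split w).1)).2 = 0 := by
    change X.classical.coord.symm (fun i => (split w).1.1 (.inr i)) = 0
    rw [hX, map_zero]
  have hY' : (Y.pt (split w).2).2 = 0 := by
    change Y.classical.coord.symm (fun i => (split w).2.1 (.inr i)) = 0
    rw [hY, map_zero]
  let dot (n : ℕ) (c : Fin n → ZMod p) : (Fin n → ZMod p) →ₗ[ZMod p] ZMod p :=
    { toFun := fun v => v ⬝ᵥ c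
      map_add' := fun a b => add_dotProduct a b c
      map_smul' := fun t a => smul_dotProduct t a c }
  have := h (X.pt (conj (split w).1)).1 (Y.pt (split w).2).1
    (dot _ (fun i => (conj (split w).1).2 (.inr i)) ∘ₗ X.classical.coord.toLinearMap)
    (-(dot _ (fun i => (split w).2.2 (.inr i)) ∘ₗ Y.classical.coord.toLinearMap)) fun d hd => by
      have h1 := hform d hd 0 0
      simp only [zero_dotProduct, sub_zero] at h1
      rw [← X.quantum.alt.neg_eq, ← Y.quantum.alt.neg_eq] at h1
      change - _ + _ + X.classical.coord d.1.2 ⬝ᵥ (fun i => (conj (split w).1).2 (.inr i)) +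
        -(Y.classical.coord d.2.2 ⬝ᵥ (fun i => (split w).2.2 (.inr i))) = 0
      linear_combination -h1
  rw [Submodule.mem_comap, ptPair_apply]
  convert this using 3

theorem sum_rot {A B C : Type} [Fintype A] [Fintype B] [Fintype C] (F : A → B → C → ℂ) :
    ∑ a, ∑ b, ∑ c, F a b c = ∑ c, ∑ a, ∑ b, F a b c := by
  rw [Finset.sum_comm (s := (Finset.univ : Finset C))]
  exact Finset.sum_congr rfl fun _ _ => Finset.sum_comm

theorem choiMap_phaseSum (h2 : (2 : ZMod p) ≠ 0) (X Y : QCSpace p) (R : Set (X.Pt × Y.Pt))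
    (m : ℕ) (hm : ∀ x, Nat.card {y : Y.Pt // (x, y) ∈ R} = p ^ m) :
    choiMap (phaseSum (ptPair X Y ⁻¹' R)) =
      (p : ℂ) ^ ((Module.finrank (ZMod p) X.classical.carrier : ℤ) +
        Module.finrank (ZMod p) Y.classical.carrier + X.quantum.qupits + m) • relMap X Y R := by
  classical
  have h1 (ρ : Op p X.wires) : choiMap (phaseSum (ptPair X Y ⁻¹' R)) ρ =
      ∑ u : Phase p X.wires, ∑ v : Phase p Y.wires,
        (if (X.pt u, Y.pt v) ∈ R then (phaseOp u * ρ).trace else 0) • phaseOp v := by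
    have h0 (x x' : X.wires → ZMod p) (y y' : Y.wires → ZMod p) :
        phaseSum (ptPair X Y ⁻¹' R) (Sum.elim x y) (Sum.elim x' y') =
        ∑ u : Phase p X.wires, ∑ v : Phase p Y.wires,
          if (X.pt u, Y.pt v) ∈ R then phaseOp u x' x * phaseOp v y y' else 0 := by
      rw [← Fintype.sum_prod_type', phaseSum, Matrix.sum_apply]
      refine Fintype.sum_equiv (split.trans (conj.toEquiv.prodCongr (Equiv.refl _))) _ _ fun w => ?_
      have e1 : ((X.pt (conj (split w).1), Y.pt (split w).2) ∈ R) ↔ w ∈ ptPair X Y ⁻¹' R := Iff.rfl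
      change _ = if (X.pt (conj (split w).1), Y.pt (split w).2) ∈ R then
        phaseOp (conj (split w).1) x' x * phaseOp (split w).2 y y' else 0
      rw [phaseOp_conj]
      by_cases h : w ∈ ptPair X Y ⁻¹' R
      · rw [if_pos h, if_pos (e1.2 h), phaseOp_sum]; rfl
      · rw [if_neg h, if_neg (fun h' => h (e1.1 h'))]; rfl
    ext y y'
    change ∑ x : X.wires → ZMod p, ∑ x' : X.wires → ZMod p, ρ x x' *
      phaseSum (ptPair X Y ⁻¹' R) (Sum.elim x y) (Sum.elim x' y') = _
    simp only [h0, Finset.mul_sum]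
    rw [sum_rot, Matrix.sum_apply]
    refine Finset.sum_congr rfl fun u _ => ?_
    rw [sum_rot, Matrix.sum_apply]
    refine Finset.sum_congr rfl fun v _ => ?_
    rw [Matrix.smul_apply, smul_eq_mul]
    split_ifs
    · rw [Matrix.trace, Finset.sum_comm, Finset.sum_mul]
      simp only [Matrix.diag_apply, Matrix.mul_apply, Finset.sum_mul]
      exact Finset.sum_congr rfl fun _ _ => Finset.sum_congr rfl fun _ _ => by ring
    · simp
  ext1 ρ
  rw [h1, LinearMap.smul_apply, relMap_apply hm, sum_lift, Finset.smul_sum]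
  refine Finset.sum_congr rfl fun x _ => ?_
  have h4 (b) : (∑ v : Phase p Y.wires,
      (if (X.pt (X.lift x b), Y.pt v) ∈ R then (phaseOp (X.lift x b) * ρ).trace else 0) • phaseOp v) =
      ∑ y : Y.Pt, (if (x, y) ∈ R then (phaseOp (X.lift x b) * ρ).trace else 0) •
        (p : ℂ) ^ Module.finrank (ZMod p) Y.classical.carrier • Y.pointOp y := by
    rw [sum_lift]
    refine Finset.sum_congr rfl fun y _ => ?_
    simp only [pt_lift]
    rw [← Finset.smul_sum, sum_phaseOp_lift h2]
  rw [Finset.sum_congr rfl fun b _ => h4 b, Finset.sum_comm]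
  simp only [Finset.smul_sum]
  refine Finset.sum_congr rfl fun y _ => ?_
  rw [← Finset.sum_smul]
  split_ifs
  · rw [← Matrix.trace_sum, ← Finset.sum_mul, sum_phaseOp_lift h2]
    simp only [Matrix.smul_mul, Matrix.trace_smul, smul_smul, smul_eq_mul]
    congr 1
    rw [zpow_add₀ p_ne_zero, zpow_add₀ p_ne_zero, zpow_add₀ p_ne_zero]
    have := p_ne_zero (p := p)
    push_cast
    simp only [zpow_natCast]
    field_simp
  · simp

theorem relMap_isMixedStab (h2 : (2 : ZMod p) ≠ 0) {X Y : QCSpace p} {R : Set (X.Pt × Y.Pt)}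
    (hR : X.Good Y R) (hT : relTotal R) : IsMixedStab (relMap X Y R) := by
  obtain ⟨a, S, hC, hS⟩ := exists_coset hR hT
  obtain ⟨m, hm⟩ := exists_fiber_card hC hT
  have hC' : IsCoset (ptPair X Y ⁻¹' R) (liftPair X Y a 0 0) (S.comap (ptPair X Y)) := fun w => by
    rw [Set.mem_preimage, hC, Submodule.mem_comap, map_sub, ptPair_liftPair]
  have h := isMixedStab_choiMap h2 hC' (coisotropic_comap hS)
  rw [choiMap_phaseSum h2 X Y R m hm] at h
  have h' := h.smul (-((Module.finrank (ZMod p) X.classical.carrier : ℤ) +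
        Module.finrank (ZMod p) Y.classical.carrier + X.quantum.qupits + m))
  rwa [smul_smul, ← zpow_add₀ p_ne_zero, neg_add_cancel, zpow_zero, one_smul] at h'

theorem good_id (X : QCSpace p) : X.Good X (relId X.Pt) := (ARQRel.id X).good

/-- The object of `StabChan_p` that represents a type. -/
noncomputable def toStabChan (h2 : (2 : ZMod p) ≠ 0) (X : QCSpace p) : StabChan p where
  wires := X.wires
  idem := X.dephase
  isMixedStab := by
    rw [← relMap_id h2]
    exact relMap_isMixedStab h2 X.good_id (relTotal_id _)
  selfAdjoint := X.dephase_selfAdjoint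
  idem_comp_idem := X.dephase_idem
  ne_zero := X.dephase_ne_zero

end QCSpace

theorem two_ne_zero_of_odd {p : ℕ} [Fact p.Prime] (hp : p ≠ 2) : (2 : ZMod p) ≠ 0 := fun h => by
  have h1 : ((2 : ℕ) : ZMod p) = 0 := by exact_mod_cast h
  rw [ZMod.natCast_eq_zero_iff] at h1
  exact hp ((Nat.prime_dvd_prime_iff_eq Fact.out Nat.prime_two).1 h1)

/-- The equivalence `Total(AR^Q) ≃ StabChan_p`, as a functor: a type is sent to its register, with the
classical part decohered, and a total relation `R` to the channel that averages the phase-point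
operators of the points `y` with `(x, y) ∈ R`. -/
noncomputable def symplecticRep (p : ℕ) [Fact p.Prime] (hp : p ≠ 2) : TotalARQ p ⥤ StabChan p where
  obj X := X.space.toStabChan (two_ne_zero_of_odd hp)
  map {X Y} f :=
    { map := QCSpace.relMap X.space Y.space f.rel
      isMixedStab := QCSpace.relMap_isMixedStab (two_ne_zero_of_odd hp) f.isARQ.good f.total
      absorb := by
        have h2 := two_ne_zero_of_odd hp
        change Y.space.dephase ∘ₗ _ ∘ₗ X.space.dephase = _
        rw [← QCSpace.relMap_id h2, ← QCSpace.relMap_id h2,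
          ← QCSpace.relMap_comp h2 (QCSpace.good_id _) (relTotal_id _) f.isARQ.good f.total,
          id_relComp, ← QCSpace.relMap_comp h2 f.isARQ.good f.total (QCSpace.good_id _)
          (relTotal_id _), relComp_id]
      causal := QCSpace.relMap_trace (two_ne_zero_of_odd hp) f.isARQ.good f.total }
  map_id X := StabChan.Hom.ext (QCSpace.relMap_id (two_ne_zero_of_odd hp) X.space)
  map_comp f g := StabChan.Hom.ext (QCSpace.relMap_comp (two_ne_zero_of_odd hp) f.isARQ.good f.total
    g.isARQ.good g.total)

/-! Relational composition records only which outputs are possible. A channel, being linear, also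
has to record how often each output occurs. The representation on `AR^Q` can ignore this gap because
relations there are cosets: all nonempty fibres of an affine relation have the same size, so
"possible" and "uniformly distributed" carry the same information. Multiplication breaks this. It
maps the plane onto the line, but its fibres are unequal: zero has `2p - 1` preimages, every other
element has `p - 1`.

Suppose an extension existed, and let `M` be the linear map it assigns to multiplication,
transported along the natural isomorphism. Two families of equations in `Total(NL^Q)` have the form
"an `AR^Q` relation, then multiplication, equals an `AR^Q` relation". A deterministic point `(a, b)`
followed by multiplication is the point `ab`, so `M` takes the basis projector of `(a, b)` to that
of `ab`. The relation allowing every point of the plane, followed by multiplication, is the relation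
allowing every point of the line, since multiplication is onto; so `M` takes the uniform mixture on
the plane to the uniform mixture on the line. The uniform mixture on the plane is the average of the
projectors already treated, hence by linearity its image weights each `c` in proportion to the
number of pairs with product `c`. Uniformity would give every fibre exactly `p` elements, whereas
the fibre over zero has more.

`exists_map_of_extension` extracts one `M` that serves for all tests. `pointHom_comp_mulHom` and
`uniformHom_comp_mulHom` are the two relational identities. `card_fiber_mul_card` is the
linear-algebra step, resting on orthogonality of the point operators for the trace form, and
`card_lt_card_mulPt_eq_zero` gives the oversized fibre. -/

namespace QCSpace

variable {p : ℕ} [Fact p.Prime]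

/-! ### Constant affine relations and multiplication as total morphisms -/

/-- The total relation from `X` to a classical space that relates every point to every element of a
nonempty affine subspace `A`. -/
def constHom (X : TotalARQ p) (W : VecSpace p) (A : AffineSubspace (ZMod p) W.carrier)
    (hA : (A : Set W.carrier).Nonempty) : X ⟶ (⟨ofClassical W⟩ : TotalARQ p) where
  rel := {r | r.2.2 ∈ A}
  isARQ := by
    have h := ARQRel.glue X.space (ofClassical W) Set.univ {s | s.2 ∈ A}
      -- The quantum parts are left unconstrained: the whole space is coisotropic because it
      -- contains every complement.
      (Or.inr ⟨⊤, rfl, by rw [AffineSubspace.direction_top]; exact le_top⟩)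
      ⟨A.comap (LinearMap.snd (ZMod p) X.space.classical.carrier W.carrier).toAffineMap, rfl⟩
    convert h using 1
    ext r
    exact (iff_of_eq (true_and _)).symm
  -- Nonemptiness of `A` is exactly what totality needs. The quantum coordinate of the target has
  -- only the value zero.
  total _ := 
    let ⟨w, hw⟩ := hA
    ⟨((0 : (SympSpace.std p 0).carrier), w), hw⟩

/-- The multiplication relation is total. -/
theorem mulRel_total : relTotal (mulRel p) := fun x =>
  -- The factors are the two coordinates of the input. That they reassemble to it is checked on the
  -- lists of entries.
  ⟨(0, ![x.2 0 * x.2 1]), x.2 0, x.2 1, List.ofFn_inj.1 (by simp), rfl⟩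

/-- Multiplication, as a morphism of `Total(NL^Q)`. -/
def mulHom (p : ℕ) [Fact p.Prime] : (⟨ofClassical (VecSpace.std p 2)⟩ : TotalNLQ p) ⟶
    (⟨ofClassical (VecSpace.std p 1)⟩ : TotalNLQ p) :=
  ⟨mulRel p, .mul, mulRel_total⟩

/-- The two factors are determined by the input, so the existential quantifiers can be eliminated.
This exhibits the relation as a graph, the form in which composites with it are computed below. -/
theorem mem_mulRel {r : (ofClassical (VecSpace.std p 2)).Pt × (ofClassical (VecSpace.std p 1)).Pt} :
    r ∈ mulRel p ↔ r.2.2 0 = r.1.2 0 * r.1.2 1 := by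
  constructor
  · rintro ⟨a, b, h1, h2⟩
    rw [h1, h2]; rfl
  · intro h
    refine ⟨r.1.2 0, r.1.2 1, ?_, ?_⟩
    · ext i; fin_cases i <;> rfl
    · ext i; fin_cases i; exact h

/-- A purely classical type still carries a zero-dimensional quantum summand. This instance lets
equality of its points be decided on the classical coordinate alone. -/
instance subsingleton_std_zero : Subsingleton (SympSpace.std p 0).carrier :=
  inferInstanceAs (Subsingleton ((Fin 0 → ZMod p) × (Fin 0 → ZMod p)))

/-! ### The linear map forced by an extension -/

/-- The image of a channel between classical spaces under an extension of the symplectic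
representation is compatible with composition with relations of `AR^Q`. -/
theorem exists_map_of_extension {hp : p ≠ 2} {F : TotalNLQ p ⥤ StabChan p}
    (α : totalInclusion p ⋙ F ≅ symplecticRep p hp) {X Y : TotalARQ p}
    (m : (totalInclusion p).obj X ⟶ (totalInclusion p).obj Y) :
    ∃ M : Op p X.space.wires →ₗ[ℂ] Op p Y.space.wires,
      ∀ (Z : TotalARQ p) (f : Z ⟶ X) (g : Z ⟶ Y),
        (totalInclusion p).map f ≫ m = (totalInclusion p).map g →
        M ∘ₗ relMap Z.space X.space f.rel = relMap Z.space Y.space g.rel := by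
  -- Conjugating by the components of `α` moves the image of `m` onto the registers of `X` and `Y`.
  -- The map is fixed before `Z`, `f` and `g`, so different tests constrain the same linear map.
  refine ⟨StabChan.Hom.map (α.inv.app X ≫ F.map m ≫ α.hom.app Y), fun Z f g h => ?_⟩
  have h1 : (symplecticRep p hp).map f ≫ α.inv.app X ≫ F.map m ≫ α.hom.app Y =
      (symplecticRep p hp).map g := by
    -- Naturality of the inverse carries `f` inside `F`, where it merges with `m` and the hypothesis
    -- turns the composite into the image of `g`. Naturality of `α` brings `g` back out, and the two
    -- components at `Z` cancel.
    rw [α.inv.naturality_assoc, Functor.comp_map, ← F.map_comp_assoc, h, ← Functor.comp_map,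
      α.hom.naturality, α.inv_hom_id_app_assoc]
  -- Composition of channels is by definition composition of the underlying linear maps, in the
  -- opposite order.
  exact congrArg StabChan.Hom.map h1

/-! ### Constant relations acting on point operators -/

/-- Each fibre is a single point, so the normalising factor is 1 and the average has one term. The
relation enters through a membership criterion so that `mem_pointHom` can be supplied directly. -/
theorem relMap_pointOp_of_mem_iff_eq (h2 : (2 : ZMod p) ≠ 0) {X Y : QCSpace p} {y : Y.Pt}
    {R : Set (X.Pt × Y.Pt)} (hR : ∀ r, r ∈ R ↔ r.2 = y) (x : X.Pt) :
    relMap X Y R (X.pointOp x) = Y.pointOp y := by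
  rw [relMap_pointOp h2 (r := 1) fun x => by simp [hR], Finset.sum_eq_single y]
  · simp [hR]
  · intro b _ hb; simp [hR, hb]
  · simp

/-- Each fibre is the whole target, so the average runs over all points. This is where "anything is
possible" becomes a definite probability distribution, the uniform one. -/
theorem relMap_univ_pointOp (h2 : (2 : ZMod p) ≠ 0) {X Y : QCSpace p} (x : X.Pt) :
    relMap X Y Set.univ (X.pointOp x) = (Nat.card Y.Pt : ℂ)⁻¹ • ∑ y, Y.pointOp y := by
  rw [relMap_pointOp h2 (r := Nat.card Y.Pt) fun x =>
    Nat.card_congr (Equiv.subtypeUnivEquiv fun _ => Set.mem_univ _)]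
  simp [Finset.smul_sum]

/-! ### Counting fibres -/

/-- A linear map that acts on points by a function and preserves the uniform distribution comes
from a function all of whose fibres have the same size. -/
theorem card_fiber_mul_card (h2 : (2 : ZMod p) ≠ 0) {X Y : QCSpace p}
    {M : Op p X.wires →ₗ[ℂ] Op p Y.wires} {φ : X.Pt → Y.Pt}
    (hφ : ∀ x, M (X.pointOp x) = Y.pointOp (φ x))
    (hM : M ((Nat.card X.Pt : ℂ)⁻¹ • ∑ x, X.pointOp x) =
      (Nat.card Y.Pt : ℂ)⁻¹ • ∑ y, Y.pointOp y) (y : Y.Pt) :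
    Nat.card {x // y = φ x} * Nat.card Y.Pt = Nat.card X.Pt := by
  classical
  -- Linearity: the image of the uniform mixture is the average of the operators at `φ x`, with
  -- repetitions.
  rw [map_smul, map_sum] at hM
  simp only [hφ] at hM
  -- Point operators are orthogonal for the trace form with common square norm `p ^
  -- Y.quantum.qupits`, so pairing with the one at `y` reads off its coefficient on both sides.
  have htr := congrArg (fun ρ => (Y.pointOp y * ρ).trace) hM
  have hq : (p : ℂ) ^ Y.quantum.qupits ≠ 0 := pow_ne_zero _ p_ne_zero
  -- The equation is oriented as `y = φ x` because that is how the orthogonality relation produces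
  -- it; the fibre in the conclusion follows suit.
  have hsum : ∑ x : X.Pt, (if y = φ x then (p : ℂ) ^ Y.quantum.qupits else 0) =
      (Nat.card {x // y = φ x} : ℂ) * (p : ℂ) ^ Y.quantum.qupits := by
    rw [← sum_ite_card, Finset.sum_mul]
    exact Finset.sum_congr rfl fun x _ => by simp
  simp only [Matrix.mul_smul, Matrix.trace_smul, Matrix.mul_sum, Matrix.trace_sum,
    trace_pointOp_mul h2, smul_eq_mul] at htr
  rw [hsum, Finset.sum_ite_eq, if_pos (Finset.mem_univ _), ← mul_assoc] at htr
  -- With the common norm cancelled, what remains is that the fibre size over the number of points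
  -- of `X` equals the reciprocal of the number of points of `Y`. Clearing denominators gives an
  -- identity of natural numbers.
  have h3 := mul_right_cancel₀ hq htr
  have hX : (Nat.card X.Pt : ℂ) ≠ 0 := Nat.cast_ne_zero.2 Nat.card_pos.ne'
  have hY : (Nat.card Y.Pt : ℂ) ≠ 0 := Nat.cast_ne_zero.2 Nat.card_pos.ne'
  field_simp at h3
  exact_mod_cast h3

/-- Multiplication, as a function on points. -/
def mulPt (x : (ofClassical (VecSpace.std p 2)).Pt) : (ofClassical (VecSpace.std p 1)).Pt :=
  (0, ![x.2 0 * x.2 1])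

/-- The solutions of `ab = 0` form the union of the two coordinate axes. One whole axis together
with a single further point on the other already gives `p + 1` solutions, so the exact count `2p -
1` is not needed. -/
theorem card_lt_card_mulPt_eq_zero :
    p < Nat.card {x : (ofClassical (VecSpace.std p 2)).Pt // 0 = mulPt x} := by
  -- `Option` supplies the one extra element: `some b` is the point `(0, b)` on the axis and `none`
  -- is the point `(1, 0)` off it.
  let f : Option (ZMod p) → {x : (ofClassical (VecSpace.std p 2)).Pt // 0 = mulPt x} :=
    fun o => o.elim ⟨(0, ![1, 0]), by ext <;> simp [mulPt]⟩
      fun b => ⟨(0, ![0, b]), by ext <;> simp [mulPt]⟩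
  -- The first coordinate separates the extra point from the axis, and the second separates the
  -- points of the axis.
  have hf : Function.Injective f := by
    rintro (_ | a) (_ | b) h
    · rfl
    · exact absurd (congrArg (fun y => y.1.2 0) h) one_ne_zero
    · exact absurd (congrArg (fun y => y.1.2 0) h) zero_ne_one
    · exact congrArg some (congrArg (fun y => y.1.2 1) h)
  have h := Nat.card_le_card_of_injective f hf
  -- The bound `p + 1 ≤ _` is the strict inequality by definition.
  rwa [Finite.card_option, Nat.card_zmod] at h

/-! ### The two test morphisms and their composites with multiplication -/

/-- The point `x`, as a morphism of `Total(AR^Q)` into a classical space. -/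
def pointHom (X : TotalARQ p) (W : VecSpace p) (x : (ofClassical W).Pt) :
    X ⟶ (⟨ofClassical W⟩ : TotalARQ p) :=
  constHom X W (AffineSubspace.mk' x.2 (⊥ : Submodule (ZMod p) W.carrier))
    ⟨x.2, AffineSubspace.self_mem_mk' _ _⟩

/-- An affine subspace with zero direction is a single point. It fixes only the classical
coordinate, and the quantum coordinate agrees because its space is trivial. -/
theorem mem_pointHom {X : TotalARQ p} {W : VecSpace p} {x : (ofClassical W).Pt}
    (r : X.space.Pt × (ofClassical W).Pt) : r ∈ (pointHom X W x).rel ↔ r.2 = x := by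
  change r.2.2 ∈ AffineSubspace.mk' x.2 (⊥ : Submodule (ZMod p) W.carrier) ↔ _
  rw [AffineSubspace.mem_mk', Submodule.mem_bot, vsub_eq_zero_iff_eq, Prod.ext_iff]
  exact (and_iff_right (Subsingleton.elim _ _)).symm

/-- The uniform distribution, as a morphism of `Total(AR^Q)` into a classical space. -/
def uniformHom (X : TotalARQ p) (W : VecSpace p) : X ⟶ (⟨ofClassical W⟩ : TotalARQ p) :=
  constHom X W ⊤ ⟨0, trivial⟩

theorem uniformHom_rel (X : TotalARQ p) (W : VecSpace p) : (uniformHom X W).rel = Set.univ :=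
  Set.eq_univ_of_forall fun _ => trivial

/-- Multiplication is single-valued, so a determined input leaves a determined output. The composite
is again affine even though multiplication is not, which is what lets the symplectic representation
evaluate it. -/
theorem pointHom_comp_mulHom (X : TotalARQ p) (x : (ofClassical (VecSpace.std p 2)).Pt) :
    (totalInclusion p).map (pointHom X _ x) ≫ mulHom p =
      (totalInclusion p).map (pointHom X _ (mulPt x)) := by
  refine TotalNLQ.Hom.ext (Set.ext fun r => ⟨?_, fun h => ?_⟩)
  · rintro ⟨y, hy, hyr⟩
    -- The intermediate point of the composite can only be the prescribed one.
    obtain rfl : y = x := (mem_pointHom (r.1, y)).1 hy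
    refine (mem_pointHom r).2 (Prod.ext (Subsingleton.elim _ _) (funext fun i => ?_))
    fin_cases i
    exact mem_mulRel.1 hyr
  · refine ⟨x, (mem_pointHom (r.1, x)).2 rfl, mem_mulRel.2 ?_⟩
    exact congrArg (fun y => y.2 0) ((mem_pointHom r).1 h)

/-- Multiplication is onto, and a relational composite does not see how many pairs have a given
product. This loss of multiplicity is the source of the contradiction. -/
theorem uniformHom_comp_mulHom (X : TotalARQ p) :
    (totalInclusion p).map (uniformHom X (VecSpace.std p 2)) ≫ mulHom p =
      (totalInclusion p).map (uniformHom X (VecSpace.std p 1)) :=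
  TotalNLQ.Hom.ext (Set.ext fun r => ⟨fun _ => trivial, fun _ =>
    -- Surjectivity is witnessed by `c = 1 * c`.
    ⟨(0, ![1, r.2.2 0]), trivial, mem_mulRel.2 (one_mul _).symm⟩⟩)

end QCSpace

/-! ### The contradiction -/

open QCSpace in
theorem mainTheorem10 (p : ℕ) [Fact p.Prime] (hp : p ≠ 2) :
    ¬ ∃ F : TotalNLQ p ⥤ StabChan p, Nonempty (totalInclusion p ⋙ F ≅ symplecticRep p hp) := by
  rintro ⟨F, ⟨α⟩⟩
  have h2 := two_ne_zero_of_odd hp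
  -- The source is the one-point type: a morphism out of it, evaluated at the operator of its only
  -- point, is a state.
  let I : TotalARQ p := ⟨ofClassical (VecSpace.std p 0)⟩
  obtain ⟨M, hM⟩ := exists_map_of_extension α (mulHom p)
  -- First test: on deterministic states `M` must compute the product.
  have hpt (x) : M (pointOp _ x) = pointOp _ (mulPt x) := by
    have h := LinearMap.congr_fun (hM I _ _ (pointHom_comp_mulHom I x)) (I.space.pointOp 0)
    rwa [LinearMap.comp_apply, relMap_pointOp_of_mem_iff_eq h2 mem_pointHom,
      relMap_pointOp_of_mem_iff_eq h2 mem_pointHom] at h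
  -- Second test: the same `M` must preserve the uniform mixture.
  have hunif := LinearMap.congr_fun (hM I _ _ (uniformHom_comp_mulHom I)) (I.space.pointOp 0)
  rw [LinearMap.comp_apply, uniformHom_rel, uniformHom_rel, relMap_univ_pointOp h2,
    relMap_univ_pointOp h2] at hunif
  have hcard (n : ℕ) : Nat.card (ofClassical (VecSpace.std p n)).Pt = p ^ n := by
    simp [Nat.card_eq_fintype_card, ZMod.card]
  -- Over zero, the two tests together say that the fibre size times `p` is `p ^ 2`. Cancelling `p`
  -- leaves exactly `p` solutions of `ab = 0`, which is too few.
  have h := card_fiber_mul_card h2 hpt hunif 0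
  rw [hcard, hcard, pow_one, sq] at h
  exact card_lt_card_mulPt_eq_zero.ne' (Nat.eq_of_mul_eq_mul_right (Fact.out : p.Prime).pos h)
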